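/- For real random variables (or laws) $X,Y$ write $X \succcurlyeq_{\rm ssd} Y$ (second order stochastic dominance) if $\mathbb{E}[u(X)] \ge \mathbb{E}[u(Y)]$ for every concave nondecreasing $u:\mathbb{R}\to\mathbb{R}$, expectations being taken in the extended reals. Let $v \in [0,1]^S$ and let $\alpha \in \mathbb{R}^S$ with $\alpha_s \ge 0$ for all $s$ and $\sum_s \alpha_s > 0$. Let $P$ be a random vector with $P \sim \mathrm{Dirichlet}(\alpha)$, that is, $P$ has the law of $(\gamma_1,\dots,\gamma_S)/\sum_s\gamma_s$ with independent $\gamma_s\sim\mathrm{Gamma}(\alpha_s,1)$, where $\mathrm{Gamma}(0,1)$ is the unit mass at $0$; let $X = P^\top v$. Conditionally on $P$, let $Z_1,\dots,Z_n$ be i.i.d. samples from the categorical distribution $P$ on $\{1,\dots,S\}$, so that the $i$-th observed value is $v_{Z_i}$. Let $Y$ have the prior distribution $N(\mu,\sigma^2)$ with $$\mu = \frac{\sum_{s} \alpha_s v_s}{\sum_{s} \alpha_s}, \qquad \sigma^2 = \Big(\sum_{s} \alpha_s\Big)^{-1}.$$ Let $z \in \{1,\dots,S\}^n$ be any dataset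 with $\alpha_{z_i} > 0$ for all $i$ (which is automatic when all $\alpha_s$ are positive), and suppose $n + \sum_{s} \alpha_s \ge 2$. Let $\tilde X$ be distributed as $X$ conditioned on the data, and let $\tilde Y$ be distributed according to the posterior of $Y$ obtained by Bayes' rule with the misspecified likelihood that treats the values $v_{z_1},\dots,v_{z_n}$ as independent $N(Y,1)$ observations, i.e. the law proportional to $\prod_{i=1}^n e^{-(v_{z_i}-y)^2/2}\, N(\mu,\sigma^2)(dy)$. Then $$\tilde X \succcurlyeq_{\rm ssd} \tilde Y .$$ This holds both when the data record the categories (conditioning on $Z_i = z_i$ for all $i$) and when they record only the values (conditioning on $v_{Z_i} = v_{z_i}$ for all $i$). -/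

import Mathlib

open MeasureTheory ProbabilityTheory
open scoped ENNReal

/-- The law of a standard (unit scale) Gamma variable with shape `a`; shape `0` is the unit mass
at `0`. -/
noncomputable def stdGamma (a : ℝ) : Measure ℝ :=
  if a = 0 then Measure.dirac 0 else gammaMeasure a 1

/-- The Dirichlet distribution with parameters `α i ≥ 0`, not all zero, in Ferguson's form: the law
of `(γ₁, …, γ_S) / (γ₁ + ⋯ + γ_S)` for independent `γ i ∼ Gamma(α i, 1)`. For positive parameters
this is the law with density proportional to `∏ p i ^ (α i - 1)` on the simplex; a coordinate with
parameter zero vanishes almost surely. -/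
noncomputable def dirichletMeasure {S : ℕ} (α : Fin S → ℝ) : Measure (Fin S → ℝ) :=
  (Measure.pi fun i => stdGamma (α i)).map fun g i => g i / ∑ j, g j

/-- Given the random probability vector `P`, the variables `Z 1, …, Z n` are independent samples
from the categorical distribution `P`:
`ℙ(Z 1 = z 1, …, Z n = z n | P) = P (z 1) ⋯ P (z n)` almost surely. -/
def IsIIDCategoricalGiven {Ω : Type*} [MeasurableSpace Ω] (Pr : Measure Ω) {S n : ℕ}
    (P : Ω → Fin S → ℝ) (Z : Fin n → Ω → Fin S) : Prop :=
  ∀ z : Fin n → Fin S,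
    Pr⟦{ω | ∀ i, Z i ω = z i} | MeasurableSpace.comap P inferInstance⟧
      =ᵐ[Pr] fun ω => ∏ i, P ω (z i)

/-- Bayes' rule: the posterior of a parameter with law `prior` under the likelihood function `L`
is the normalization of `L θ · prior(dθ)`. -/
noncomputable def bayesPosterior {Θ : Type*} [MeasurableSpace Θ] (prior : Measure Θ)
    (L : Θ → ℝ≥0∞) : Measure Θ :=
  (∫⁻ θ, L θ ∂prior)⁻¹ • prior.withDensity L

/-- The posterior of `Y ∼ N(m, s)` (`s` the variance) when the observations `x 1, …, x n` are
treated as independent `N(Y, 1)` variables. -/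
noncomputable def gaussianPosterior (m : ℝ) (s : NNReal) {n : ℕ} (x : Fin n → ℝ) : Measure ℝ :=
  bayesPosterior (gaussianReal m s) fun y => ∏ i, gaussianPDF y 1 (x i)

/-- The expectation of `u` under `ν` as an extended real number, `E[u⁺] - E[u⁻]`. For `u` concave
and `ν` a probability measure of finite mean, `E[u⁺]` is finite, so this never reads `∞ - ∞`. -/
noncomputable def extExpectation (ν : Measure ℝ) (u : ℝ → ℝ) : EReal :=
  ((∫⁻ x, ENNReal.ofReal (u x) ∂ν : ℝ≥0∞) : EReal) -
    ((∫⁻ x, ENNReal.ofReal (-u x) ∂ν : ℝ≥0∞) : EReal)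

/-- Second order stochastic dominance of the law `ν₁` for the law `ν₂`: `E_{ν₁} u ≥ E_{ν₂} u` for
all concave nondecreasing `u : ℝ → ℝ`. -/
def SecondOrderDominates (ν₁ ν₂ : Measure ℝ) : Prop :=
  ∀ u : ℝ → ℝ, ConcaveOn ℝ Set.univ u → Monotone u →
    extExpectation ν₂ u ≤ extExpectation ν₁ u

/-!
Both posteriors are explicit. The Dirichlet law is conjugate to categorical sampling, so given the
sample `z` the vector `P` is Dirichlet with parameter `β`, where `β` adds to `α` the counts of `z`;
given only the values, its law is a mixture of such laws over the samples with these values. The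
Gaussian posterior is `N(m, 1/N)` with `N = ∑ β = n + ∑ α` and `m = ∑ β v / N`, the same for all
samples with these values. It remains to show that `P ⬝ v` with `P ∼ Dirichlet(β)` dominates
`N(m(β), 1/N)` (`ConcaveOn.integral_gaussianReal_le_dirichletMeasure`). It suffices to test this on
Lipschitz concave functions `w`, because `P ⬝ v ∈ [0, 1]`
(`secondOrderDominates_of_lipschitz`).

The proof runs a Pólya urn. A Dirichlet law is the mixture, with weights `β s / N`, of the Dirichlet
laws with one parameter raised by one (`dirichletMeasure_eq_sum`), and along such a step the mean
moves, without drift, within an interval of length `1 / (N + 1)`. A centred law on an interval of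
length `d` dominates `N(0, d²)`; for two-point laws this comes down to the inequality
`Φ (1 - Φ) ≤ φ` for the normal distribution function and density
(`ConcaveOn.integral_gaussianReal_le_two_point`). Since
`1 / N = 1 / (N (N + 1)) + 1 / (N + 1)` and `1 / (N + 1)² ≤ 1 / (N (N + 1))`, the first summand of
the normal variance pays for the step, and the second is the variance that belongs to the total
parameter `N + 1`. So the dominance gap at `β` is at least the average of the gaps one step later.
The Dirichlet law concentrates at its mean as the total parameter grows, while the normal average of
`w` is at most the value of `w` at the mean, so the gaps are at least `- K / √(N + k + 1)` after `k`
steps, and the gap at `β` is nonnegative.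

The mixture identity rests on `p s · Dirichlet(β) = (β s / N) · Dirichlet(β + e_s)`. It follows from
size biasing of the Gamma law of shape `β s`, once the sum of the Gamma variables is separated from
their direction. As an exponential tilt of Gamma variables is a change of scale, the Laplace
transform of the sum factorizes against functions of the direction, and integrating it gives the
inverse of the sum (`lintegral_direction_mul_inv_sum`).
-/

/-! ### Concave functions -/

/-- A concave function on the line has a supporting line above its graph at every point. -/
lemma ConcaveOn.exists_supergradient {u : ℝ → ℝ} (hu : ConcaveOn ℝ Set.univ u) (y : ℝ) :
    ∃ c : ℝ, ∀ x, u x ≤ u y + c * (x - y) := by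
  have hf : ConvexOn ℝ Set.univ (-u) := hu.neg
  have hy : y ∈ interior (Set.univ : Set ℝ) := by simp
  refine ⟨-derivWithin (-u) (Set.Ioi y) y, fun x => ?_⟩
  rcases lt_trichotomy x y with h | rfl | h
  · have h1 := hf.slope_le_leftDeriv_of_mem_interior (Set.mem_univ x) hy h
    have h2 := hf.leftDeriv_le_rightDeriv_of_mem_interior hy
    have h3 := h1.trans h2
    rw [slope_def_field, div_le_iff₀ (by linarith)] at h3
    simp only [Pi.neg_apply] at h3
    linarith
  · simp
  · have h1 := hf.rightDeriv_le_slope_of_mem_interior hy (Set.mem_univ x) h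
    rw [slope_def_field, le_div_iff₀ (by linarith)] at h1
    simp only [Pi.neg_apply] at h1
    linarith

/-- Supporting slopes of a function decrease. -/
lemma supergradient_anti {u : ℝ → ℝ} {x y a b : ℝ} (ha : ∀ z, u z ≤ u x + a * (z - x))
    (hb : ∀ z, u z ≤ u y + b * (z - y)) (hxy : x < y) : b ≤ a := by
  have h1 := ha y
  have h2 := hb x
  nlinarith

/-- A concave `u` has a Lipschitz concave majorant that agrees with `u` on `[0, 1]`: the infimum of
the supporting lines of `u` at the points of `[0, 1]`. -/
lemma ConcaveOn.exists_lipschitz_majorant {u : ℝ → ℝ} (hu : ConcaveOn ℝ Set.univ u) :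
    ∃ (w : ℝ → ℝ) (K : NNReal), ConcaveOn ℝ Set.univ w ∧ LipschitzWith K w ∧ (∀ x, u x ≤ w x) ∧
      ∀ x ∈ Set.Icc (0 : ℝ) 1, w x = u x := by
  choose c hc using hu.exists_supergradient
  have : Nonempty (Set.Icc (0 : ℝ) 1) := ⟨⟨0, by simp⟩⟩
  let l : Set.Icc (0 : ℝ) 1 → ℝ → ℝ := fun y x => u y + c y * (x - y)
  have hbdd : ∀ x, BddBelow (Set.range fun y => l y x) := fun x =>
    ⟨u x, by rintro _ ⟨y, rfl⟩; exact hc y x⟩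
  have hle : ∀ x y, (⨅ y, l y x) ≤ l y x := fun x y => ciInf_le (hbdd x) y
  have hcb : ∀ y : Set.Icc (0 : ℝ) 1, |c y| ≤ max |c 0| |c 1| := by
    rintro ⟨y, hy0, hy1⟩
    have h0 : c y ≤ c 0 := by
      rcases hy0.eq_or_lt with h | h
      · rw [← h]
      · exact supergradient_anti (hc 0) (hc y) h
    have h1 : c 1 ≤ c y := by
      rcases hy1.eq_or_lt with h | h
      · rw [h]
      · exact supergradient_anti (hc y) (hc 1) h
    exact abs_le_max_abs_abs h1 h0 |>.trans (max_comm _ _).le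
  refine ⟨fun x => ⨅ y, l y x, Real.toNNReal (max |c 0| |c 1|), ⟨convex_univ, ?_⟩, ?_, ?_, ?_⟩
  · intro x _ z _ a b ha hb hab
    refine le_ciInf fun y => ?_
    have h1 := mul_le_mul_of_nonneg_left (hle x y) ha
    have h2 := mul_le_mul_of_nonneg_left (hle z y) hb
    have h3 : l y (a • x + b • z) = a * l y x + b * l y z := by
      obtain rfl : b = 1 - a := by linarith
      simp only [l, smul_eq_mul]; ring
    rw [h3]
    simp only [smul_eq_mul]
    linarith
  · refine LipschitzWith.of_le_add_mul _ fun x z => ?_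
    rw [← sub_le_iff_le_add]
    refine le_ciInf fun y => ?_
    have h1 := hle x y
    have h2 : c y * (x - z) ≤ max |c 0| |c 1| * dist x z := by
      rw [Real.dist_eq]
      exact (le_abs_self _).trans ((abs_mul _ _).le.trans
        (mul_le_mul_of_nonneg_right (hcb y) (abs_nonneg _)))
    have h3 : l y x = l y z + c y * (x - z) := by simp only [l]; ring
    rw [Real.coe_toNNReal _ (by positivity)]
    linarith
  · exact fun x => le_ciInf fun y => hc y x
  · intro x hx
    refine le_antisymm ((hle x ⟨x, hx⟩).trans (by simp [l])) (le_ciInf fun y => hc y x)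

/-- Among the centred laws on an interval of length `d`, the two-point law on its end points is the
worst for a concave function: the chord over the interval lies below the function. -/
lemma ConcaveOn.two_point_le_sum {ι : Type*} [Fintype ι] {w : ℝ → ℝ}
    (hw : ConcaveOn ℝ Set.univ w) {q v : ι → ℝ} (hq : ∀ i, 0 ≤ q i) (hq1 : ∑ i, q i = 1)
    (hv : ∀ i, v i ∈ Set.Icc (0 : ℝ) 1) {p : ℝ} (hp : ∑ i, q i * v i = p) (m d : ℝ) :
    (1 - p) * w (m - p * d) + p * w (m + (1 - p) * d) ≤ ∑ i, q i * w (m + (v i - p) * d) := by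
  have h : ∀ i, (1 - v i) * w (m - p * d) + v i * w (m + (1 - p) * d) ≤ w (m + (v i - p) * d) := by
    intro i
    have := hw.2 (Set.mem_univ (m - p * d)) (Set.mem_univ (m + (1 - p) * d))
      (sub_nonneg.2 (hv i).2) (hv i).1 (by ring)
    simp only [smul_eq_mul] at this
    refine this.trans (le_of_eq ?_)
    congr 1; ring
  calc (1 - p) * w (m - p * d) + p * w (m + (1 - p) * d)
      = ∑ i, q i * ((1 - v i) * w (m - p * d) + v i * w (m + (1 - p) * d)) := by
        have e : ∀ i, q i * ((1 - v i) * w (m - p * d) + v i * w (m + (1 - p) * d)) =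
          q i * w (m - p * d) + q i * v i * (w (m + (1 - p) * d) - w (m - p * d)) := by
          intro i; ring
        simp_rw [e]
        rw [Finset.sum_add_distrib, ← Finset.sum_mul, ← Finset.sum_mul, hq1, hp]
        ring
    _ ≤ _ := Finset.sum_le_sum fun i _ => mul_le_mul_of_nonneg_left (h i) (hq i)

/-- For a law on `[0, 1]`, second order dominance needs to be tested on Lipschitz concave functions
only. -/
lemma secondOrderDominates_of_lipschitz {ν₁ ν₂ : Measure ℝ} (h₁ : ∀ᵐ x ∂ν₁, x ∈ Set.Icc (0 : ℝ) 1)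
    (hi₁ : ∀ (w : ℝ → ℝ) (K : NNReal), LipschitzWith K w → Integrable w ν₁)
    (hi₂ : ∀ (w : ℝ → ℝ) (K : NNReal), LipschitzWith K w → Integrable w ν₂)
    (h : ∀ (w : ℝ → ℝ) (K : NNReal), ConcaveOn ℝ Set.univ w → LipschitzWith K w →
      ∫ x, w x ∂ν₂ ≤ ∫ x, w x ∂ν₁) :
    SecondOrderDominates ν₁ ν₂ := by
  intro u hu _
  obtain ⟨w, K, hw, hL, huw, hwu⟩ := hu.exists_lipschitz_majorant
  have key : ∀ ν : Measure ℝ, Integrable w ν →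
      extExpectation ν w = ((∫ x, w x ∂ν : ℝ) : EReal) := by
    intro ν hi
    rw [integral_eq_lintegral_pos_part_sub_lintegral_neg_part hi, extExpectation, EReal.coe_sub,
      EReal.coe_ennreal_toReal, EReal.coe_ennreal_toReal]
    · exact hi.neg.lintegral_lt_top.ne
    · exact hi.lintegral_lt_top.ne
  calc extExpectation ν₂ u ≤ extExpectation ν₂ w := by
        refine EReal.sub_le_sub ?_ ?_
        · exact EReal.coe_ennreal_le_coe_ennreal_iff.2
            (lintegral_mono fun x => ENNReal.ofReal_le_ofReal (huw x))
        · exact EReal.coe_ennreal_le_coe_ennreal_iff.2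
            (lintegral_mono fun x => ENNReal.ofReal_le_ofReal (neg_le_neg (huw x)))
    _ = ((∫ x, w x ∂ν₂ : ℝ) : EReal) := key _ (hi₂ w K hL)
    _ ≤ ((∫ x, w x ∂ν₁ : ℝ) : EReal) := EReal.coe_le_coe_iff.2 (h w K hw hL)
    _ = extExpectation ν₁ w := (key _ (hi₁ w K hL)).symm
    _ = extExpectation ν₁ u := by
        unfold extExpectation
        congr 2 <;> refine lintegral_congr_ae ?_ <;> filter_upwards [h₁] with x hx <;>
          rw [hwu x hx]

/-! ### The standard normal law -/

lemma gaussianPDFReal_std (x : ℝ) :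
    gaussianPDFReal 0 1 x = (√(2 * Real.pi))⁻¹ * Real.exp (-x ^ 2 / 2) := by
  simp [gaussianPDFReal]

lemma gaussianPDFReal_std_neg (x : ℝ) : gaussianPDFReal 0 1 (-x) = gaussianPDFReal 0 1 x := by
  simp [gaussianPDFReal_std]

lemma hasDerivAt_gaussianPDFReal_std (x : ℝ) :
    HasDerivAt (gaussianPDFReal 0 1) (-x * gaussianPDFReal 0 1 x) x := by
  have h : HasDerivAt (fun x : ℝ => (√(2 * Real.pi))⁻¹ * Real.exp (-x ^ 2 / 2))
      ((√(2 * Real.pi))⁻¹ * (Real.exp (-x ^ 2 / 2) * (-(2 * x) / 2))) x := by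
    have := (((hasDerivAt_pow 2 x).neg.div_const 2).exp).const_mul (√(2 * Real.pi))⁻¹
    simpa using this
  have e : gaussianPDFReal 0 1 = fun x : ℝ => (√(2 * Real.pi))⁻¹ * Real.exp (-x ^ 2 / 2) :=
    funext gaussianPDFReal_std
  rw [e]
  convert h using 1
  ring

lemma continuous_gaussianPDFReal_std : Continuous (gaussianPDFReal 0 1) :=
  continuous_iff_continuousAt.2 fun x => (hasDerivAt_gaussianPDFReal_std x).continuousAt

lemma gaussianPDFReal_std_le_half (x : ℝ) : gaussianPDFReal 0 1 x ≤ 1 / 2 := by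
  rw [gaussianPDFReal_std]
  have h1 : (2 : ℝ) ≤ √(2 * Real.pi) := by
    apply Real.le_sqrt_of_sq_le
    nlinarith [Real.pi_gt_three]
  have h2 : Real.exp (-x ^ 2 / 2) ≤ 1 := Real.exp_le_one_iff.2 (by nlinarith [sq_nonneg x])
  have h3 : (√(2 * Real.pi))⁻¹ ≤ 2⁻¹ := inv_anti₀ (by norm_num) h1
  calc _ ≤ 2⁻¹ * (1 : ℝ) := by gcongr
    _ = 1 / 2 := by norm_num

lemma tendsto_gaussianPDFReal_std_atTop :
    Filter.Tendsto (gaussianPDFReal 0 1) Filter.atTop (nhds 0) := by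
  have h : Filter.Tendsto (fun x : ℝ => (√(2 * Real.pi))⁻¹ * Real.exp (-x ^ 2 / 2)) Filter.atTop
      (nhds ((√(2 * Real.pi))⁻¹ * 0)) := by
    refine Filter.Tendsto.const_mul _ (Real.tendsto_exp_atBot.comp ?_)
    have : Filter.Tendsto (fun x : ℝ => x ^ 2 / 2) Filter.atTop Filter.atTop :=
      (Filter.tendsto_pow_atTop two_ne_zero).atTop_div_const (by norm_num)
    exact (Filter.tendsto_neg_atTop_atBot.comp this).congr fun x => by simp [neg_div]
  rw [mul_zero] at h
  exact h.congr fun x => (gaussianPDFReal_std x).symm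

/-- The first moment of the standard normal law on a right half-line is the density at its end
point. -/
lemma setIntegral_Ioi_gaussianReal_std (t : ℝ) :
    ∫ x in Set.Ioi t, x ∂gaussianReal 0 1 = gaussianPDFReal 0 1 t := by
  have hint : Integrable (fun x : ℝ => x) (gaussianReal 0 1) :=
    (memLp_id_gaussianReal 1).integrable (by simp)
  rw [gaussianReal_of_var_ne_zero 0 one_ne_zero] at hint ⊢
  have hm : Measurable (gaussianPDF 0 1) := measurable_gaussianPDF 0 1
  have hlt : ∀ᵐ x ∂(volume : Measure ℝ), gaussianPDF 0 1 x < ∞ :=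
    ae_of_all _ fun x => gaussianPDF_lt_top
  rw [integrable_withDensity_iff_integrable_smul' hm hlt] at hint
  rw [setIntegral_withDensity_eq_setIntegral_toReal_smul hm (ae_restrict_of_ae hlt) _
    measurableSet_Ioi]
  simp only [toReal_gaussianPDF, smul_eq_mul] at hint ⊢
  have := integral_Ioi_of_hasDerivAt_of_tendsto' (f := fun x => - gaussianPDFReal 0 1 x)
    (f' := fun x => gaussianPDFReal 0 1 x * x) (a := t) (m := 0)
    (fun x _ => (hasDerivAt_gaussianPDFReal_std x).neg.congr_deriv (by ring))
    hint.integrableOn (by simpa using tendsto_gaussianPDFReal_std_atTop.neg)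
  rw [this]; ring

/-- The standard normal distribution function. -/
noncomputable def stdNormalCDF (t : ℝ) : ℝ := (gaussianReal 0 1).real (Set.Iic t)

lemma stdNormalCDF_eq_integral (t : ℝ) :
    stdNormalCDF t = ∫ x in Set.Iic t, gaussianPDFReal 0 1 x := by
  rw [stdNormalCDF, measureReal_def, gaussianReal_apply_eq_integral 0 one_ne_zero,
    ENNReal.toReal_ofReal]
  exact integral_nonneg fun x => gaussianPDFReal_nonneg 0 1 x

lemma hasDerivAt_stdNormalCDF (t : ℝ) :
    HasDerivAt stdNormalCDF (gaussianPDFReal 0 1 t) t := by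
  have h : stdNormalCDF = fun t => stdNormalCDF 0 + ∫ x in (0 : ℝ)..t, gaussianPDFReal 0 1 x := by
    funext t
    rw [stdNormalCDF_eq_integral, stdNormalCDF_eq_integral,
      ← intervalIntegral.integral_Iic_sub_Iic (integrable_gaussianPDFReal 0 1).integrableOn
        (integrable_gaussianPDFReal 0 1).integrableOn]
    ring
  rw [h]
  exact (intervalIntegral.integral_hasDerivAt_right
    (continuous_gaussianPDFReal_std.intervalIntegrable _ _)
    continuous_gaussianPDFReal_std.stronglyMeasurable.stronglyMeasurableAtFilter
    continuous_gaussianPDFReal_std.continuousAt).const_add _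

lemma stdNormalCDF_nonneg (t : ℝ) : 0 ≤ stdNormalCDF t := measureReal_nonneg

lemma stdNormalCDF_le_one (t : ℝ) : stdNormalCDF t ≤ 1 := measureReal_le_one

lemma measureReal_Ioi_gaussianReal_std (t : ℝ) :
    (gaussianReal 0 1).real (Set.Ioi t) = 1 - stdNormalCDF t := by
  rw [← Set.compl_Iic, probReal_compl_eq_one_sub measurableSet_Iic, stdNormalCDF]

lemma stdNormalCDF_neg (t : ℝ) : stdNormalCDF (-t) = 1 - stdNormalCDF t := by
  have h : (gaussianReal 0 1).map (fun x => -x) = gaussianReal 0 1 := by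
    rw [gaussianReal_map_neg, neg_zero]
  have : NullSingletonClass (gaussianReal 0 1) := nullSingletonClass_gaussianReal one_ne_zero
  rw [← measureReal_Ioi_gaussianReal_std, measureReal_def, measure_congr Ioi_ae_eq_Ici,
    ← measureReal_def, stdNormalCDF, ← h, map_measureReal_apply measurable_neg measurableSet_Iic, h]
  congr 1
  ext x
  simp

lemma tendsto_stdNormalCDF_atTop :
    Filter.Tendsto stdNormalCDF Filter.atTop (nhds 1) := by
  have := tendsto_cdf_atTop (gaussianReal 0 1)
  exact this.congr fun x => by rw [cdf_eq_real, stdNormalCDF]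

lemma tendsto_stdNormalCDF_atBot :
    Filter.Tendsto stdNormalCDF Filter.atBot (nhds 0) := by
  have := tendsto_cdf_atBot (gaussianReal 0 1)
  exact this.congr fun x => by rw [cdf_eq_real, stdNormalCDF]

lemma exists_stdNormalCDF_eq {p : ℝ} (h0 : 0 < p) (h1 : p < 1) : ∃ t, stdNormalCDF t = p := by
  have hc : Continuous stdNormalCDF :=
    continuous_iff_continuousAt.2 fun x => (hasDerivAt_stdNormalCDF x).continuousAt
  obtain ⟨a, ha⟩ := (tendsto_stdNormalCDF_atBot.eventually (gt_mem_nhds h0)).exists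
  obtain ⟨b, hb⟩ := (tendsto_stdNormalCDF_atTop.eventually (lt_mem_nhds h1)).exists
  exact mem_range_of_exists_le_of_exists_ge hc ⟨a, ha.le⟩ ⟨b, hb.le⟩

/-- `Φ (1 - Φ) ≤ φ` for the standard normal law. On `[0, ∞)` the difference `φ - Φ (1 - Φ)` has
derivative `φ (2 Φ - 1 - t) ≤ 0`, and it is at least `- (1 - Φ) → 0`. -/
lemma stdNormalCDF_mul_one_sub_le (t : ℝ) :
    stdNormalCDF t * (1 - stdNormalCDF t) ≤ gaussianPDFReal 0 1 t := by
  wlog ht : 0 ≤ t generalizing t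
  · have := this (-t) (by linarith)
    rw [stdNormalCDF_neg, gaussianPDFReal_std_neg] at this
    linarith
  have hlin : ∀ x, 0 ≤ x → 2 * stdNormalCDF x - 1 ≤ x := by
    intro x hx
    have hmono : Monotone fun x => x - 2 * stdNormalCDF x := by
      refine monotone_of_hasDerivAt_nonneg (f' := fun x => 1 - 2 * gaussianPDFReal 0 1 x)
        (fun x => (hasDerivAt_id x).sub ((hasDerivAt_stdNormalCDF x).const_mul 2)) fun x => ?_
      have := gaussianPDFReal_std_le_half x
      simp only [Pi.zero_apply]
      linarith
    have h0 := stdNormalCDF_neg 0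
    rw [neg_zero] at h0
    have := hmono hx
    simp only at this
    linarith
  let h : ℝ → ℝ := fun x => gaussianPDFReal 0 1 x - stdNormalCDF x * (1 - stdNormalCDF x)
  have hder : ∀ x, HasDerivAt h (gaussianPDFReal 0 1 x * (2 * stdNormalCDF x - 1 - x)) x := by
    intro x
    have hΦ := hasDerivAt_stdNormalCDF x
    exact ((hasDerivAt_gaussianPDFReal_std x).sub (hΦ.mul (hΦ.const_sub 1))).congr_deriv (by ring)
  have hanti : AntitoneOn h (Set.Ici 0) := by
    refine antitoneOn_of_deriv_nonpos (convex_Ici 0)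
      (fun x _ => (hder x).continuousAt.continuousWithinAt)
      (fun x _ => (hder x).differentiableAt.differentiableWithinAt) fun x hx => ?_
    rw [interior_Ici] at hx
    rw [(hder x).deriv]
    exact mul_nonpos_of_nonneg_of_nonpos (gaussianPDFReal_nonneg 0 1 x)
      (by linarith [hlin x (le_of_lt hx)])
  have hlim : Filter.Tendsto (fun x => -(1 - stdNormalCDF x)) Filter.atTop (nhds 0) := by
    simpa using (tendsto_stdNormalCDF_atTop.const_sub 1).neg
  have : 0 ≤ h t := by
    refine le_of_tendsto hlim ?_
    filter_upwards [Filter.eventually_ge_atTop t] with x hx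
    refine le_trans ?_ (hanti (Set.mem_Ici.2 ht) (Set.mem_Ici.2 (ht.trans hx)) hx)
    have h1 := stdNormalCDF_nonneg x
    have h2 := stdNormalCDF_le_one x
    have h3 := gaussianPDFReal_nonneg 0 1 x
    simp only [h]
    nlinarith
  simp only [h] at this
  linarith

/-! ### Normal averages of concave functions -/

lemma LipschitzWith.integrable_of_integrable_id {w : ℝ → ℝ} {K : NNReal} (hw : LipschitzWith K w)
    {ν : Measure ℝ} [IsFiniteMeasure ν] (hν : Integrable (fun x => x) ν) : Integrable w ν := by
  refine Integrable.mono' (g := fun x => ‖w 0‖ + K * ‖x‖)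
    ((integrable_const _).add (hν.norm.const_mul _)) hw.continuous.aestronglyMeasurable
    (ae_of_all _ fun x => ?_)
  have h := hw.dist_le_mul x 0
  rw [dist_zero_right, dist_eq_norm] at h
  have := norm_sub_norm_le (w x) (w 0)
  linarith

lemma LipschitzWith.integrable_gaussianReal {w : ℝ → ℝ} {K : NNReal} (hw : LipschitzWith K w)
    (m : ℝ) (s : NNReal) : Integrable w (gaussianReal m s) :=
  hw.integrable_of_integrable_id ((memLp_id_gaussianReal 1).integrable (by simp))

lemma ConcaveOn.integral_gaussianReal_le {w : ℝ → ℝ} (hw : ConcaveOn ℝ Set.univ w) {K : NNReal}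
    (hK : LipschitzWith K w) (m : ℝ) (s : NNReal) : ∫ x, w x ∂gaussianReal m s ≤ w m := by
  have := hw.le_map_integral (μ := gaussianReal m s) (f := fun x => x) hK.continuous.continuousOn
    isClosed_univ (ae_of_all _ fun _ => Set.mem_univ _)
    ((memLp_id_gaussianReal 1).integrable (by simp)) (hK.integrable_gaussianReal m s)
  simpa using this

/-- A centred two-point law with gap `d` dominates every centred normal law of variance at least
`d ^ 2`. The normal law is split at its quantile into parts of mass `1 - p` and `p`, on which `w` is
bounded by its supporting lines at the two points; this exceeds the two-point average by
`(c₁ - c₀) (√s φ(t) - d p (1 - p)) ≤ 0`, where `c₁ ≤ c₀` are the slopes. -/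
lemma ConcaveOn.integral_gaussianReal_le_two_point {w : ℝ → ℝ} (hw : ConcaveOn ℝ Set.univ w)
    {K : NNReal} (hK : LipschitzWith K w) {p : ℝ} (hp0 : 0 ≤ p) (hp1 : p ≤ 1) {d : ℝ} (hd : 0 < d)
    {s : NNReal} (hs : d ^ 2 ≤ s) (m : ℝ) :
    ∫ x, w x ∂gaussianReal m s ≤ (1 - p) * w (m - p * d) + p * w (m + (1 - p) * d) := by
  rcases hp0.eq_or_lt with rfl | hp0
  · simpa using hw.integral_gaussianReal_le hK m s
  rcases hp1.eq_or_lt with rfl | hp1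
  · simpa using hw.integral_gaussianReal_le hK m s
  have hds : d ≤ √(s : ℝ) := Real.le_sqrt_of_sq_le hs
  set h := √(s : ℝ) with hh
  have hsq : h ^ 2 = s := Real.sq_sqrt s.2
  have hmap : gaussianReal m s = (gaussianReal 0 1).map (fun x => m + h * x) := by
    have : (fun x : ℝ => m + h * x) = (fun x => m + x) ∘ fun x => h * x := rfl
    rw [this, ← Measure.map_map (by fun_prop) (by fun_prop), gaussianReal_map_const_mul,
      gaussianReal_map_const_add]
    congr 1
    · ring
    · ext; simp [hsq]
  obtain ⟨t, ht⟩ := exists_stdNormalCDF_eq (p := 1 - p) (by linarith) (by linarith)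
  obtain ⟨c₀, hc₀⟩ := hw.exists_supergradient (m - p * d)
  obtain ⟨c₁, hc₁⟩ := hw.exists_supergradient (m + (1 - p) * d)
  have hc : c₁ ≤ c₀ := supergradient_anti hc₀ hc₁ (by nlinarith)
  have hφ := stdNormalCDF_mul_one_sub_le t
  rw [ht] at hφ
  have hid : Integrable (fun x : ℝ => x) (gaussianReal 0 1) :=
    (memLp_id_gaussianReal 1).integrable (by simp)
  have hwi : Integrable (fun x => w (m + h * x)) (gaussianReal 0 1) := by
    have := hK.integrable_gaussianReal m s
    rw [hmap, integrable_map_measure hK.continuous.aestronglyMeasurable (by fun_prop)] at this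
    exact this
  have hI := setIntegral_Ioi_gaussianReal_std t
  have hI' : ∫ x in Set.Iic t, x ∂gaussianReal 0 1 = -gaussianPDFReal 0 1 t := by
    have h1 := integral_add_compl (s := Set.Iic t) measurableSet_Iic hid
    rw [Set.compl_Iic, hI, integral_id_gaussianReal] at h1
    linarith
  have hlinear : ∀ (A : Set ℝ) (a b : ℝ), ∫ x in A, (a + b * x) ∂gaussianReal 0 1 =
      a * (gaussianReal 0 1).real A + b * ∫ x in A, x ∂gaussianReal 0 1 := by
    intro A a b
    rw [integral_add (integrable_const _) (hid.integrableOn.const_mul b), integral_const_mul]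
    simp [mul_comm]
  have hlini : ∀ a b : ℝ, Integrable (fun x => a + b * x) (gaussianReal 0 1) :=
    fun a b => (integrable_const _).add (hid.const_mul b)
  have h₀ : ∫ x in Set.Iic t, w (m + h * x) ∂gaussianReal 0 1 ≤
      (w (m - p * d) + c₀ * (p * d)) * (1 - p) + (c₀ * h) * -gaussianPDFReal 0 1 t := by
    have e : (gaussianReal 0 1).real (Set.Iic t) = 1 - p := ht
    rw [← e, ← hI', ← hlinear]
    refine setIntegral_mono hwi.integrableOn (hlini _ _).integrableOn fun x => ?_
    refine (hc₀ _).trans (le_of_eq ?_)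
    ring
  have h₁ : ∫ x in Set.Ioi t, w (m + h * x) ∂gaussianReal 0 1 ≤
      (w (m + (1 - p) * d) - c₁ * ((1 - p) * d)) * p + (c₁ * h) * gaussianPDFReal 0 1 t := by
    have e : (gaussianReal 0 1).real (Set.Ioi t) = p := by
      rw [measureReal_Ioi_gaussianReal_std, ht]; ring
    rw [← e, ← hI, ← hlinear, e]
    refine setIntegral_mono hwi.integrableOn (hlini _ _).integrableOn fun x => ?_
    refine (hc₁ _).trans (le_of_eq ?_)
    ring
  rw [hmap, integral_map (by fun_prop) hK.continuous.aestronglyMeasurable,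
    ← integral_add_compl (s := Set.Iic t) measurableSet_Iic hwi, Set.compl_Iic]
  have hJ : d * (p * (1 - p)) ≤ h * gaussianPDFReal 0 1 t := by
    have h1 : p * (1 - p) ≤ gaussianPDFReal 0 1 t := by linarith
    have h2 : 0 ≤ p * (1 - p) := by nlinarith
    exact mul_le_mul hds h1 h2 (hd.le.trans hds)
  nlinarith [mul_nonneg (sub_nonneg.2 hc) (sub_nonneg.2 hJ)]

/-- Convolution with a centred normal law, acting on functions. -/
noncomputable def gaussianSmoothing (s : NNReal) (w : ℝ → ℝ) (x : ℝ) : ℝ :=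
  ∫ y, w (x + y) ∂gaussianReal 0 s

lemma LipschitzWith.integrable_comp_add_gaussianReal {w : ℝ → ℝ} {K : NNReal}
    (hw : LipschitzWith K w) (x m : ℝ) (s : NNReal) :
    Integrable (fun y => w (x + y)) (gaussianReal m s) := by
  have : LipschitzWith K fun y => w (x + y) := LipschitzWith.of_dist_le_mul fun a b =>
    (hw.dist_le_mul _ _).trans (by rw [dist_add_left])
  exact this.integrable_gaussianReal m s

lemma LipschitzWith.gaussianSmoothing {w : ℝ → ℝ} {K : NNReal} (hw : LipschitzWith K w)
    (s : NNReal) : LipschitzWith K (gaussianSmoothing s w) := by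
  refine LipschitzWith.of_le_add_mul _ fun x z => ?_
  have h : ∫ y, w (x + y) ∂gaussianReal 0 s ≤
      ∫ y, (w (z + y) + K * dist x z) ∂gaussianReal 0 s := by
    refine integral_mono (hw.integrable_comp_add_gaussianReal x 0 s)
      ((hw.integrable_comp_add_gaussianReal z 0 s).add (integrable_const _)) fun y => ?_
    have := hw.dist_le_mul (x + y) (z + y)
    rw [dist_add_right, Real.dist_eq] at this
    linarith [le_abs_self (w (x + y) - w (z + y))]
  rw [integral_add (hw.integrable_comp_add_gaussianReal z 0 s) (integrable_const _)] at h
  simpa [_root_.gaussianSmoothing] using h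

lemma ConcaveOn.gaussianSmoothing {w : ℝ → ℝ} (hw : ConcaveOn ℝ Set.univ w) {K : NNReal}
    (hK : LipschitzWith K w) (s : NNReal) : ConcaveOn ℝ Set.univ (gaussianSmoothing s w) := by
  refine ⟨convex_univ, fun x _ z _ a b ha hb hab => ?_⟩
  have hx := hK.integrable_comp_add_gaussianReal x 0 s
  have hz := hK.integrable_comp_add_gaussianReal z 0 s
  simp only [_root_.gaussianSmoothing, smul_eq_mul]
  rw [← integral_const_mul, ← integral_const_mul, ← integral_add (hx.const_mul a) (hz.const_mul b)]
  refine integral_mono ((hx.const_mul a).add (hz.const_mul b))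
    (hK.integrable_comp_add_gaussianReal _ 0 s) fun y => ?_
  have := hw.2 (Set.mem_univ (x + y)) (Set.mem_univ (z + y)) ha hb hab
  simp only [smul_eq_mul] at this
  refine this.trans (le_of_eq ?_)
  congr 1
  linear_combination y * hab

lemma integral_gaussianReal_eq_gaussianSmoothing {w : ℝ → ℝ} {K : NNReal} (hK : LipschitzWith K w)
    (x : ℝ) (s : NNReal) : ∫ y, w y ∂gaussianReal x s = gaussianSmoothing s w x := by
  have : gaussianReal x s = (gaussianReal 0 s).map (fun y => x + y) := by
    rw [gaussianReal_map_const_add, zero_add]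
  rw [this, integral_map (by fun_prop) hK.continuous.aestronglyMeasurable, gaussianSmoothing]

lemma integral_gaussianReal_add_var {w : ℝ → ℝ} {K : NNReal} (hK : LipschitzWith K w)
    (m : ℝ) (s₁ s₂ : NNReal) :
    ∫ y, w y ∂gaussianReal m (s₁ + s₂) = ∫ x, gaussianSmoothing s₂ w x ∂gaussianReal m s₁ := by
  have h : gaussianReal m (s₁ + s₂) = (gaussianReal m s₁).conv (gaussianReal 0 s₂) := by
    rw [gaussianReal_conv_gaussianReal, add_zero]
  have hi := hK.integrable_gaussianReal m (s₁ + s₂)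
  rw [h] at hi ⊢
  exact integral_conv hi

/-! ### The Gaussian posterior -/

/-- Normalization: the posterior is `ν` as soon as the weighted prior is a finite positive multiple
of the probability measure `ν`. -/
lemma bayesPosterior_eq_of_withDensity_eq_smul {Θ : Type*} [MeasurableSpace Θ] {prior : Measure Θ}
    {L : Θ → ℝ≥0∞} {ν : Measure Θ} [IsProbabilityMeasure ν] {c : ℝ≥0∞} (hc : c ≠ 0) (hc' : c ≠ ∞)
    (h : prior.withDensity L = c • ν) : bayesPosterior prior L = ν := by
  have hL : ∫⁻ θ, L θ ∂prior = c := by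
    rw [← setLIntegral_univ, ← withDensity_apply _ MeasurableSet.univ, h]
    simp
  rw [bayesPosterior, hL, h, smul_smul, ENNReal.inv_mul_cancel hc hc', one_smul]

lemma gaussianPDFReal_toNNReal_inv {N : ℝ} (hN : 0 < N) (m y : ℝ) :
    gaussianPDFReal m (Real.toNNReal N⁻¹) y =
      (√(2 * Real.pi * N⁻¹))⁻¹ * Real.exp (-(N * (y - m) ^ 2 / 2)) := by
  rw [gaussianPDFReal, Real.coe_toNNReal _ (inv_pos.2 hN).le]
  congr 2
  field_simp

/-- Conjugacy: precisions add, and the posterior mean is the precision-weighted mean of the prior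
mean and the observations. -/
lemma gaussianPosterior_eq {N : ℝ} (hN : 0 < N) (m : ℝ) {n : ℕ} (x : Fin n → ℝ) :
    gaussianPosterior m (Real.toNNReal N⁻¹) x =
      gaussianReal ((N * m + ∑ i, x i) / (N + n)) (Real.toNNReal (N + n)⁻¹) := by
  have hN' : 0 < N + n := by positivity
  have hs : Real.toNNReal N⁻¹ ≠ 0 := by simpa using hN
  have hs' : Real.toNNReal (N + n)⁻¹ ≠ 0 := by simpa using hN'
  set M := N + n with hM
  set m' := (N * m + ∑ i, x i) / M with hm'
  have hMm : M * m' = N * m + ∑ i, x i := by rw [hm']; field_simp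
  -- the normalizing constants, and the part of the exponent left after completing the square
  let C : ℝ := (√(2 * Real.pi * N⁻¹))⁻¹ * √(2 * Real.pi * M⁻¹) * ((√(2 * Real.pi))⁻¹) ^ n *
    Real.exp (-((N * m ^ 2 + ∑ i, x i ^ 2 - M * m' ^ 2) / 2))
  have hC : 0 < C := by positivity
  have key : ∀ y, gaussianPDFReal m (Real.toNNReal N⁻¹) y * ∏ i, gaussianPDFReal y 1 (x i) =
      C * gaussianPDFReal m' (Real.toNNReal M⁻¹) y := by
    intro y
    have hprod : ∏ i, gaussianPDFReal y 1 (x i) =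
        ((√(2 * Real.pi))⁻¹) ^ n * Real.exp (∑ i, -(x i - y) ^ 2 / 2) := by
      simp [gaussianPDFReal, Finset.prod_mul_distrib, Real.exp_sum]
    have hsum : ∑ i, -(x i - y) ^ 2 / 2 =
        -((∑ i, x i ^ 2 - 2 * y * ∑ i, x i + n * y ^ 2) / 2) := by
      have : ∀ i, -(x i - y) ^ 2 / 2 = -(1 / 2) * x i ^ 2 + y * x i - y ^ 2 / 2 := by
        intro i; ring
      simp_rw [this]
      rw [Finset.sum_sub_distrib, Finset.sum_add_distrib, ← Finset.mul_sum, ← Finset.mul_sum]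
      simp
      ring
    rw [hprod, hsum, gaussianPDFReal_toNNReal_inv hN, gaussianPDFReal_toNNReal_inv hN']
    have hexp : Real.exp (-(N * (y - m) ^ 2 / 2)) *
        Real.exp (-((∑ i, x i ^ 2 - 2 * y * ∑ i, x i + n * y ^ 2) / 2)) =
        Real.exp (-((N * m ^ 2 + ∑ i, x i ^ 2 - M * m' ^ 2) / 2)) *
          Real.exp (-(M * (y - m') ^ 2 / 2)) := by
      rw [← Real.exp_add, ← Real.exp_add]
      congr 1
      have e : M * (y - m') ^ 2 = M * y ^ 2 - 2 * y * (M * m') + M * m' ^ 2 := by ring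
      rw [e, hMm, hM]
      ring
    have hne : √(2 * Real.pi * M⁻¹) ≠ 0 := by positivity
    calc _ = (√(2 * Real.pi * N⁻¹))⁻¹ * ((√(2 * Real.pi))⁻¹) ^ n *
          (Real.exp (-(N * (y - m) ^ 2 / 2)) *
            Real.exp (-((∑ i, x i ^ 2 - 2 * y * ∑ i, x i + n * y ^ 2) / 2))) := by ring
      _ = _ := by
        rw [hexp]
        simp only [C]
        field_simp
  refine bayesPosterior_eq_of_withDensity_eq_smul (c := ENNReal.ofReal C) (by simpa using hC)
    ENNReal.ofReal_ne_top ?_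
  have hmeas : Measurable fun y => ∏ i, gaussianPDF y 1 (x i) := by
    refine Finset.measurable_prod _ fun i _ => ?_
    have := measurable_uncurry_gaussianPDF.comp
      (measurable_id.prodMk (measurable_const.prodMk measurable_const) :
        Measurable fun y : ℝ => (y, (1 : NNReal), x i))
    exact this
  rw [gaussianReal_of_var_ne_zero _ hs, gaussianReal_of_var_ne_zero _ hs',
    ← withDensity_mul _ (measurable_gaussianPDF _ _) hmeas,
    ← withDensity_smul _ (measurable_gaussianPDF _ _)]
  congr 1
  funext y
  simp only [Pi.mul_apply, Pi.smul_apply, smul_eq_mul, gaussianPDF]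
  rw [← ENNReal.ofReal_prod_of_nonneg fun i _ => gaussianPDFReal_nonneg _ _ _,
    ← ENNReal.ofReal_mul (gaussianPDFReal_nonneg _ _ _), ← ENNReal.ofReal_mul hC.le, key]

/-! ### Gamma variables -/

/-- A product of densities is a density for the product measure. -/
lemma pi_withDensity_prod {ι : Type*} [Fintype ι] {X : ι → Type*} [∀ i, MeasurableSpace (X i)]
    {μ : ∀ i, Measure (X i)} [∀ i, IsProbabilityMeasure (μ i)] {f : ∀ i, X i → ℝ≥0∞}
    (hf : ∀ i, Measurable (f i)) [∀ i, SigmaFinite ((μ i).withDensity (f i))] :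
    (Measure.pi μ).withDensity (fun x => ∏ i, f i (x i)) =
      Measure.pi fun i => (μ i).withDensity (f i) := by
  refine (Measure.pi_eq fun s hs => ?_).symm
  rw [withDensity_apply _ (MeasurableSet.univ_pi hs),
    ← lintegral_indicator (MeasurableSet.univ_pi hs)]
  have h : ∀ x : ∀ i, X i, (Set.univ.pi s).indicator (fun x => ∏ i, f i (x i)) x =
      ∏ i, (s i).indicator (f i) (x i) := by
    intro x
    by_cases hx : ∀ i, x i ∈ s i
    · rw [Set.indicator_of_mem (by simpa [Set.mem_pi] using hx)]
      exact Finset.prod_congr rfl fun i _ => by rw [Set.indicator_of_mem (hx i)]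
    · rw [Set.indicator_of_notMem (by simpa [Set.mem_pi] using hx)]
      push Not at hx
      obtain ⟨i, hi⟩ := hx
      exact (Finset.prod_eq_zero (Finset.mem_univ i) (Set.indicator_of_notMem hi _)).symm
  simp_rw [h]
  have hm : ∀ i, Measurable ((s i).indicator (f i)) := fun i => (hf i).indicator (hs i)
  rw [lintegral_prod_eq_prod_lintegral_of_indepFun Finset.univ
    (fun i (x : ∀ i, X i) => (s i).indicator (f i) (x i))
    (iIndepFun_pi fun i => (hm i).aemeasurable) fun i => (hm i).comp (measurable_pi_apply i)]
  refine Finset.prod_congr rfl fun i _ => ?_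
  rw [withDensity_apply _ (hs i), ← lintegral_indicator (hs i),
    (measurePreserving_eval μ i).lintegral_comp (hm i)]

lemma isProbabilityMeasure_stdGamma {a : ℝ} (ha : 0 ≤ a) : IsProbabilityMeasure (stdGamma a) := by
  unfold stdGamma
  split_ifs with h
  · infer_instance
  · exact isProbabilityMeasure_gammaMeasure (lt_of_le_of_ne ha (Ne.symm h)) one_pos

lemma measurable_gammaPDF (a r : ℝ) : Measurable (gammaPDF a r) :=
  (measurable_gammaPDFReal a r).ennreal_ofReal

lemma stdGamma_of_pos {a : ℝ} (ha : 0 < a) : stdGamma a = gammaMeasure a 1 := by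
  rw [stdGamma, if_neg ha.ne']

lemma ae_pos_stdGamma {a : ℝ} (ha : 0 < a) : ∀ᵐ x ∂stdGamma a, 0 < x := by
  rw [stdGamma_of_pos ha, gammaMeasure, ae_withDensity_iff (measurable_gammaPDF a 1)]
  have h0 : ∀ᵐ x ∂(volume : Measure ℝ), x ≠ 0 := by simp [ae_iff]
  filter_upwards [h0] with x hx h
  by_contra hneg
  exact h (gammaPDF_of_neg (lt_of_le_of_ne (not_lt.1 hneg) hx))

lemma ae_nonneg_stdGamma {a : ℝ} (ha : 0 ≤ a) : ∀ᵐ x ∂stdGamma a, 0 ≤ x := by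
  rcases ha.eq_or_lt with rfl | ha
  · simp [stdGamma, ae_dirac_eq]
  · exact (ae_pos_stdGamma ha).mono fun x hx => hx.le

/-- Size biasing raises the shape of a Gamma law by one. -/
lemma stdGamma_withDensity_id {a : ℝ} (ha : 0 < a) :
    (stdGamma a).withDensity (fun x => ENNReal.ofReal (x / a)) = stdGamma (a + 1) := by
  rw [stdGamma_of_pos ha, stdGamma_of_pos (by linarith), gammaMeasure, gammaMeasure,
    ← withDensity_mul _ (measurable_gammaPDF a 1) (by fun_prop)]
  congr 1
  funext x
  rcases lt_or_ge x 0 with hx | hx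
  · simp [gammaPDF_of_neg hx]
  · rw [Pi.mul_apply, gammaPDF_of_nonneg hx, gammaPDF_of_nonneg hx, ← ENNReal.ofReal_mul]
    · congr 1
      have hG := Real.Gamma_pos_of_pos ha
      have hx' : x ^ (a + 1 - 1) = x ^ (a - 1) * x := by
        rw [add_sub_cancel_right]
        rcases hx.eq_or_lt with rfl | hx
        · simp [Real.zero_rpow ha.ne']
        · rw [Real.rpow_sub_one hx.ne']; field_simp
      rw [Real.Gamma_add_one ha.ne', hx']
      simp only [Real.one_rpow]
      field_simp
    · have hG := Real.Gamma_pos_of_pos ha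
      positivity

/-- Changing the scale of a Gamma law amounts to tilting it exponentially. -/
lemma stdGamma_withDensity_exp {a : ℝ} (ha : 0 ≤ a) {r : ℝ} (hr : 0 < r) :
    (stdGamma a).withDensity (fun x => ENNReal.ofReal (r ^ a * Real.exp (-((r - 1) * x)))) =
      (stdGamma a).map (fun x => r⁻¹ * x) := by
  rcases ha.eq_or_lt with rfl | ha
  · simp only [stdGamma, if_true, Real.rpow_zero, one_mul]
    rw [Measure.map_dirac' (by fun_prop)]
    ext s hs
    rw [withDensity_apply _ hs, ← lintegral_indicator hs, lintegral_dirac, mul_zero,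
      Measure.dirac_apply' _ hs]
    by_cases h : (0 : ℝ) ∈ s <;> simp [h]
  · rw [stdGamma_of_pos ha]
    unfold gammaMeasure
    rw [← withDensity_mul _ (measurable_gammaPDF a 1) (by fun_prop)]
    -- both sides have the density of the Gamma law with shape `a` and rate `r`
    have hdens : ∀ y, ENNReal.ofReal r * gammaPDF a 1 (r * y) = (gammaPDF a 1 *
        fun x => ENNReal.ofReal (r ^ a * Real.exp (-((r - 1) * x)))) y := by
      intro y
      have hG := Real.Gamma_pos_of_pos ha
      rcases lt_or_ge y 0 with hy | hy
      · simp [gammaPDF_of_neg hy, gammaPDF_of_neg (mul_neg_of_pos_of_neg hr hy)]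
      · rw [Pi.mul_apply, gammaPDF_of_nonneg hy, gammaPDF_of_nonneg (mul_nonneg hr.le hy),
          ← ENNReal.ofReal_mul hr.le, ← ENNReal.ofReal_mul (by positivity)]
        congr 1
        have e : Real.exp (-(1 * (r * y))) = Real.exp (-(1 * y)) * Real.exp (-((r - 1) * y)) := by
          rw [← Real.exp_add]; congr 1; ring
        rw [Real.mul_rpow hr.le hy, Real.rpow_sub_one hr.ne', e]
        simp only [Real.one_rpow]
        field_simp
    ext s hs
    rw [Measure.map_apply (by fun_prop) hs, withDensity_apply _ hs,
      withDensity_apply _ (measurableSet_preimage (by fun_prop) hs),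
      ← lintegral_indicator hs, ← lintegral_indicator (measurableSet_preimage (by fun_prop) hs)]
    have h1 : ∀ x, ((fun x => r⁻¹ * x) ⁻¹' s).indicator (fun x => gammaPDF a 1 x) x =
        (fun y => s.indicator (fun y => gammaPDF a 1 (r * y)) y) (r⁻¹ * x) := by
      intro x
      by_cases hx : r⁻¹ * x ∈ s
      · rw [Set.indicator_of_mem (by exact hx)]
        simp only
        rw [Set.indicator_of_mem hx, mul_inv_cancel_left₀ hr.ne']
      · rw [Set.indicator_of_notMem (by exact hx)]
        simp only
        rw [Set.indicator_of_notMem hx]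
    have hm : Measurable fun y => s.indicator (fun y => gammaPDF a 1 (r * y)) y :=
      ((measurable_gammaPDF a 1).comp (by fun_prop)).indicator hs
    simp_rw [h1]
    rw [← lintegral_map hm (by fun_prop), Real.map_volume_mul_left (inv_ne_zero hr.ne'), inv_inv,
      abs_of_pos hr, lintegral_smul_measure, smul_eq_mul, ← lintegral_const_mul _ hm]
    refine lintegral_congr fun y => ?_
    by_cases hy : y ∈ s
    · rw [Set.indicator_of_mem hy, Set.indicator_of_mem hy, hdens]
    · rw [Set.indicator_of_notMem hy, Set.indicator_of_notMem hy, mul_zero]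

/-! ### Dirichlet laws -/

section Dirichlet

variable {S : ℕ} {α : Fin S → ℝ}

/-- The direction of a vector: its coordinates divided by their sum. -/
noncomputable def direction (g : Fin S → ℝ) (i : Fin S) : ℝ := g i / ∑ j, g j

@[fun_prop]
lemma measurable_direction : Measurable (direction : (Fin S → ℝ) → Fin S → ℝ) := by
  unfold direction
  fun_prop

lemma direction_smul {c : ℝ} (hc : c ≠ 0) (g : Fin S → ℝ) :
    direction (fun i => c * g i) = direction g := by
  funext i
  rw [direction, ← Finset.mul_sum, mul_div_mul_left _ _ hc, direction]

lemma dirichletMeasure_eq_map (α : Fin S → ℝ) :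
    dirichletMeasure α = (Measure.pi fun i => stdGamma (α i)).map direction := rfl

lemma isProbabilityMeasure_pi_stdGamma (hα : ∀ i, 0 ≤ α i) :
    IsProbabilityMeasure (Measure.pi fun i => stdGamma (α i)) := by
  have := fun i => isProbabilityMeasure_stdGamma (hα i)
  infer_instance

lemma isProbabilityMeasure_dirichletMeasure (hα : ∀ i, 0 ≤ α i) :
    IsProbabilityMeasure (dirichletMeasure α) := by
  have := isProbabilityMeasure_pi_stdGamma hα
  exact Measure.isProbabilityMeasure_map measurable_direction.aemeasurable

lemma ae_pi_stdGamma_nonneg (hα : ∀ i, 0 ≤ α i) :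
    ∀ᵐ g ∂Measure.pi fun i => stdGamma (α i), ∀ i, 0 ≤ g i := by
  have := fun i => isProbabilityMeasure_stdGamma (hα i)
  exact ae_all_iff.2 fun i => (Measure.quasiMeasurePreserving_eval (fun i => stdGamma (α i)) i).ae
    (ae_nonneg_stdGamma (hα i))

lemma ae_pi_stdGamma_sum_pos (hα : ∀ i, 0 ≤ α i) (hN : 0 < ∑ i, α i) :
    ∀ᵐ g ∂Measure.pi fun i => stdGamma (α i), 0 < ∑ i, g i := by
  have := fun i => isProbabilityMeasure_stdGamma (hα i)
  obtain ⟨s, -, hs⟩ := Finset.exists_lt_of_sum_lt (s := Finset.univ) (f := fun _ : Fin S => (0 : ℝ))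
    (g := α) (by simpa using hN)
  filter_upwards [ae_pi_stdGamma_nonneg hα,
    (Measure.quasiMeasurePreserving_eval (fun i => stdGamma (α i)) s).ae (ae_pos_stdGamma hs)]
    with g hg hgs
  exact Finset.sum_pos' (fun i _ => hg i) ⟨s, Finset.mem_univ s, hgs⟩

lemma ae_dirichletMeasure_mem_stdSimplex (hα : ∀ i, 0 ≤ α i) (hN : 0 < ∑ i, α i) :
    ∀ᵐ p ∂dirichletMeasure α, p ∈ stdSimplex ℝ (Fin S) := by
  have hm : MeasurableSet {p : Fin S → ℝ | p ∈ stdSimplex ℝ (Fin S)} :=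
    (isClosed_stdSimplex ℝ (Fin S)).measurableSet
  rw [dirichletMeasure_eq_map, ae_map_iff measurable_direction.aemeasurable hm]
  filter_upwards [ae_pi_stdGamma_nonneg hα, ae_pi_stdGamma_sum_pos hα hN] with g hg hs
  refine ⟨fun i => div_nonneg (hg i) hs.le, ?_⟩
  simp only [direction]
  rw [← Finset.sum_div, div_self hs.ne']

/-- The joint Laplace transform of the sum of independent Gamma variables factorizes against any
function of their direction: an exponential tilt is a change of scale, which leaves the direction
unchanged. -/
lemma lintegral_direction_mul_exp (hα : ∀ i, 0 ≤ α i) {r : ℝ} (hr : 0 < r)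
    {F : (Fin S → ℝ) → ℝ≥0∞} (hF : Measurable F) :
    ∫⁻ g, F (direction g) * ENNReal.ofReal (Real.exp (-((r - 1) * ∑ i, g i)))
        ∂(Measure.pi fun i => stdGamma (α i)) =
      ENNReal.ofReal (r ^ (-∑ i, α i)) *
        ∫⁻ g, F (direction g) ∂(Measure.pi fun i => stdGamma (α i)) := by
  have := fun i => isProbabilityMeasure_stdGamma (hα i)
  let f : Fin S → ℝ → ℝ≥0∞ := fun i x => ENNReal.ofReal (r ^ α i * Real.exp (-((r - 1) * x)))
  have hf : ∀ i, Measurable (f i) := fun i => by fun_prop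
  have hscale : ∀ i, (stdGamma (α i)).withDensity (f i) = (stdGamma (α i)).map (fun x => r⁻¹ * x) :=
    fun i => stdGamma_withDensity_exp (hα i) hr
  have : ∀ i, IsProbabilityMeasure ((stdGamma (α i)).map (fun x => r⁻¹ * x)) := fun i =>
    Measure.isProbabilityMeasure_map (by fun_prop)
  have : ∀ i, SigmaFinite ((stdGamma (α i)).withDensity (f i)) := fun i => by
    rw [hscale i]; infer_instance
  have h1 : (Measure.pi fun i => stdGamma (α i)).withDensity (fun x => ∏ i, f i (x i)) =
      (Measure.pi fun i => stdGamma (α i)).map (fun g i => r⁻¹ * g i) := by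
    rw [pi_withDensity_prod hf, Measure.pi_map_pi fun i => by fun_prop]
    congr 1
    funext i
    exact hscale i
  have hprod : ∀ g : Fin S → ℝ, ∏ i, f i (g i) = ENNReal.ofReal (r ^ (∑ i, α i)) *
      ENNReal.ofReal (Real.exp (-((r - 1) * ∑ i, g i))) := by
    intro g
    rw [← ENNReal.ofReal_prod_of_nonneg fun i _ => by positivity, Finset.prod_mul_distrib,
      ← Real.exp_sum, ← Real.rpow_sum_of_pos hr, ENNReal.ofReal_mul (by positivity)]
    congr 3
    rw [Finset.sum_neg_distrib, Finset.mul_sum]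
  have h2 := lintegral_withDensity_eq_lintegral_mul (Measure.pi fun i => stdGamma (α i))
    (f := fun x => ∏ i, f i (x i)) (by fun_prop) (hF.comp measurable_direction)
  rw [h1, lintegral_map (hF.comp measurable_direction) (by fun_prop)] at h2
  simp only [Function.comp_apply, Pi.mul_apply, direction_smul (inv_ne_zero hr.ne'), hprod] at h2
  rw [h2, ← lintegral_const_mul]
  · refine lintegral_congr fun g => ?_
    rw [← mul_assoc, ← mul_assoc, ← ENNReal.ofReal_mul (by positivity), ← Real.rpow_add hr]
    simp [mul_comm]
  · fun_prop

lemma lintegral_Ioi_exp_neg {T : ℝ} (hT : 0 < T) :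
    ∫⁻ r in Set.Ioi (1 : ℝ), ENNReal.ofReal (Real.exp (-((r - 1) * T))) = ENNReal.ofReal T⁻¹ := by
  have e : ∀ r : ℝ, Real.exp (-((r - 1) * T)) = Real.exp T * Real.exp (-T * r) := by
    intro r; rw [← Real.exp_add]; congr 1; ring
  simp_rw [e]
  rw [← ofReal_integral_eq_lintegral_ofReal
    ((integrableOn_exp_mul_Ioi (neg_lt_zero.2 hT) 1).const_mul _)
    (ae_of_all _ fun r => by positivity), integral_const_mul,
    integral_exp_mul_Ioi (neg_lt_zero.2 hT), mul_one, neg_div_neg_eq, ← mul_div_assoc,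
    ← Real.exp_add, add_neg_cancel, Real.exp_zero, one_div]

lemma lintegral_Ioi_rpow_neg {N : ℝ} (hN : 1 < N) :
    ∫⁻ r in Set.Ioi (1 : ℝ), ENNReal.ofReal (r ^ (-N)) = ENNReal.ofReal (N - 1)⁻¹ := by
  rw [← ofReal_integral_eq_lintegral_ofReal (integrableOn_Ioi_rpow_of_lt (by linarith) one_pos)
    ((ae_restrict_iff' measurableSet_Ioi).2 (ae_of_all _ fun r hr =>
      Real.rpow_nonneg (zero_le_one.trans (le_of_lt hr)) _)),
    integral_Ioi_rpow_of_lt (by linarith) one_pos, Real.one_rpow]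
  congr 1
  rw [← neg_div_neg_eq, neg_neg, one_div]
  congr 1
  ring

/-- The inverse of the sum of independent Gamma variables is uncorrelated with any function of their
direction; integrate the Laplace transform over `r ∈ (1, ∞)`. -/
lemma lintegral_direction_mul_inv_sum (hα : ∀ i, 0 ≤ α i) (hN : 1 < ∑ i, α i)
    {F : (Fin S → ℝ) → ℝ≥0∞} (hF : Measurable F) :
    ∫⁻ g, F (direction g) * ENNReal.ofReal (∑ i, g i)⁻¹ ∂(Measure.pi fun i => stdGamma (α i)) =
      ENNReal.ofReal (∑ i, α i - 1)⁻¹ *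
        ∫⁻ g, F (direction g) ∂(Measure.pi fun i => stdGamma (α i)) := by
  have := isProbabilityMeasure_pi_stdGamma hα
  have hFd : Measurable fun g : Fin S → ℝ => F (direction g) := hF.comp measurable_direction
  calc _ = ∫⁻ g : Fin S → ℝ, (∫⁻ r in Set.Ioi (1 : ℝ), F (direction g) *
        ENNReal.ofReal (Real.exp (-((r - 1) * ∑ i, g i))))
        ∂(Measure.pi fun i => stdGamma (α i)) := by
        refine lintegral_congr_ae ?_
        filter_upwards [ae_pi_stdGamma_sum_pos hα (by linarith)] with g hg
        rw [lintegral_const_mul _ (by fun_prop), lintegral_Ioi_exp_neg hg]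
    _ = ∫⁻ r in Set.Ioi (1 : ℝ), (∫⁻ g : Fin S → ℝ, F (direction g) *
        ENNReal.ofReal (Real.exp (-((r - 1) * ∑ i, g i)))
        ∂(Measure.pi fun i => stdGamma (α i))) := by
        refine lintegral_lintegral_swap (Measurable.aemeasurable ?_)
        have h1 : Measurable fun x : (Fin S → ℝ) × ℝ => F (direction x.1) :=
          hFd.comp measurable_fst
        exact h1.mul (by fun_prop)
    _ = ∫⁻ r in Set.Ioi (1 : ℝ), (ENNReal.ofReal (r ^ (-∑ i, α i)) *
        ∫⁻ g, F (direction g) ∂(Measure.pi fun i => stdGamma (α i))) := by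
        refine setLIntegral_congr_fun measurableSet_Ioi fun r hr => ?_
        exact lintegral_direction_mul_exp hα (zero_lt_one.trans hr) hF
    _ = _ := by
        rw [lintegral_mul_const _ (by fun_prop), lintegral_Ioi_rpow_neg hN]

/-- The parameter vector `α` with its entry `s` raised by one. -/
noncomputable def incr (α : Fin S → ℝ) (s : Fin S) (i : Fin S) : ℝ := α i + if i = s then 1 else 0

lemma incr_nonneg (hα : ∀ i, 0 ≤ α i) (s : Fin S) (i : Fin S) : 0 ≤ incr α s i :=
  add_nonneg (hα i) (by split_ifs <;> simp)

lemma sum_incr (α : Fin S → ℝ) (s : Fin S) : ∑ i, incr α s i = ∑ i, α i + 1 := by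
  simp [incr, Finset.sum_add_distrib]

lemma pi_stdGamma_withDensity (hα : ∀ i, 0 ≤ α i) {s : Fin S} (hs : 0 < α s) :
    (Measure.pi fun i => stdGamma (α i)).withDensity (fun g => ENNReal.ofReal (g s / α s)) =
      Measure.pi fun i => stdGamma (incr α s i) := by
  have := fun i => isProbabilityMeasure_stdGamma (hα i)
  let f : Fin S → ℝ → ℝ≥0∞ := fun i => if i = s then fun x => ENNReal.ofReal (x / α s) else 1
  have hf : ∀ i, Measurable (f i) := fun i => by
    by_cases h : i = s
    · simp only [f, h, if_true]; fun_prop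
    · simp only [f, h, if_false]; exact measurable_one
  have hone : ∀ i, (stdGamma (α i)).withDensity (f i) = stdGamma (incr α s i) := by
    intro i
    by_cases h : i = s
    · subst h
      simp only [f, if_true, incr]
      exact stdGamma_withDensity_id hs
    · simp [f, h, incr]
  have : ∀ i, SigmaFinite ((stdGamma (α i)).withDensity (f i)) := fun i => by
    have := isProbabilityMeasure_stdGamma (incr_nonneg hα s i)
    rw [hone i]; infer_instance
  have h := pi_withDensity_prod (μ := fun i => stdGamma (α i)) hf
  simp only [hone] at h
  rw [← h]
  congr 1
  funext g
  rw [Finset.prod_eq_single s (fun i _ hi => by simp [f, hi]) (by simp)]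
  simp [f]

/-- Conjugacy: weighting a Dirichlet law by the coordinate `s` raises the parameter `α s` by one. -/
lemma dirichletMeasure_withDensity_coord (hα : ∀ i, 0 ≤ α i) (hN : 0 < ∑ i, α i) (s : Fin S) :
    (dirichletMeasure α).withDensity (fun p => ENNReal.ofReal (p s)) =
      ENNReal.ofReal (α s / ∑ i, α i) • dirichletMeasure (incr α s) := by
  have := fun i => isProbabilityMeasure_stdGamma (hα i)
  have hcoord : Measurable fun p : Fin S → ℝ => ENNReal.ofReal (p s) := by fun_prop
  ext B hB
  rw [withDensity_apply _ hB, ← lintegral_indicator hB, dirichletMeasure_eq_map,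
    lintegral_map (hcoord.indicator hB) measurable_direction, Measure.smul_apply, smul_eq_mul,
    dirichletMeasure_eq_map, Measure.map_apply measurable_direction hB]
  rcases (hα s).eq_or_lt with hs | hs
  · rw [← hs]
    simp only [zero_div, ENNReal.ofReal_zero, zero_mul]
    have h0 : ∀ᵐ x ∂stdGamma (α s), x = 0 := by simp [stdGamma, ← hs, ae_dirac_eq]
    refine (lintegral_congr_ae ?_).trans lintegral_zero
    filter_upwards [(Measure.quasiMeasurePreserving_eval (fun i => stdGamma (α i)) s).ae h0]
      with g hg
    have : direction g s = 0 := by simp only [Function.eval] at hg; rw [direction, hg, zero_div]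
    by_cases h : direction g ∈ B <;> simp [h, this]
  · let F : (Fin S → ℝ) → ℝ≥0∞ := B.indicator 1
    have hF : Measurable F := measurable_one.indicator hB
    have hFd : Measurable fun g : Fin S → ℝ => F (direction g) := hF.comp measurable_direction
    calc _ = ∫⁻ g, ENNReal.ofReal (α s) * (ENNReal.ofReal (g s / α s) *
          (F (direction g) * ENNReal.ofReal (∑ i, g i)⁻¹))
          ∂(Measure.pi fun i => stdGamma (α i)) := by
          refine lintegral_congr_ae ?_
          filter_upwards [ae_pi_stdGamma_nonneg hα, ae_pi_stdGamma_sum_pos hα hN] with g hg hT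
          by_cases h : direction g ∈ B
          · simp only [F, Set.indicator_of_mem h, Pi.one_apply, one_mul]
            rw [← ENNReal.ofReal_mul (div_nonneg (hg s) hs.le), ← ENNReal.ofReal_mul hs.le]
            congr 1
            rw [direction]
            field_simp
          · simp [F, h]
      _ = ENNReal.ofReal (α s) * ∫⁻ g, F (direction g) * ENNReal.ofReal (∑ i, g i)⁻¹
          ∂(Measure.pi fun i => stdGamma (incr α s i)) := by
          rw [lintegral_const_mul _ (by fun_prop), ← pi_stdGamma_withDensity hα hs,
            lintegral_withDensity_eq_lintegral_mul _ (by fun_prop) (by fun_prop)]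
          rfl
      _ = ENNReal.ofReal (α s) * (ENNReal.ofReal (∑ i, α i)⁻¹ *
          ∫⁻ g, F (direction g) ∂(Measure.pi fun i => stdGamma (incr α s i))) := by
          rw [lintegral_direction_mul_inv_sum (incr_nonneg hα s)
            (by rw [sum_incr]; linarith) hF, sum_incr, add_sub_cancel_right]
      _ = _ := by
          rw [← mul_assoc, ← ENNReal.ofReal_mul hs.le, ← div_eq_mul_inv]
          congr 1
          have : ∀ g, F (direction g) = (direction ⁻¹' B).indicator 1 g := fun g => rfl
          simp_rw [this]
          rw [lintegral_indicator_one (measurable_direction hB)]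

/-- The Pólya urn: a Dirichlet law is the mixture of the laws with one parameter raised by one. -/
lemma dirichletMeasure_eq_sum (hα : ∀ i, 0 ≤ α i) (hN : 0 < ∑ i, α i) :
    dirichletMeasure α =
      ∑ s, ENNReal.ofReal (α s / ∑ i, α i) • dirichletMeasure (incr α s) := by
  simp_rw [← dirichletMeasure_withDensity_coord hα hN]
  ext B hB
  rw [Measure.finsetSum_apply]
  simp_rw [withDensity_apply _ hB]
  rw [← lintegral_finsetSum _ fun s _ => by fun_prop, ← setLIntegral_one]
  refine lintegral_congr_ae (ae_restrict_of_ae ?_)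
  filter_upwards [ae_dirichletMeasure_mem_stdSimplex hα hN] with p hp
  rw [← ENNReal.ofReal_sum_of_nonneg fun i _ => hp.1 i, hp.2, ENNReal.ofReal_one]

end Dirichlet

/-! ### Dirichlet averages dominate normal laws -/

section Dominance

variable {S : ℕ} {α : Fin S → ℝ}

/-- The mean of `v` with weights `α`. -/
noncomputable def weightedMean (α v : Fin S → ℝ) : ℝ := (∑ s, α s * v s) / ∑ s, α s

lemma weightedMean_mem_Icc (hα : ∀ i, 0 ≤ α i) (hN : 0 < ∑ i, α i) {v : Fin S → ℝ}
    (hv : ∀ s, v s ∈ Set.Icc (0 : ℝ) 1) : weightedMean α v ∈ Set.Icc (0 : ℝ) 1 := by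
  refine ⟨div_nonneg (Finset.sum_nonneg fun i _ => mul_nonneg (hα i) (hv i).1) hN.le, ?_⟩
  rw [weightedMean, div_le_one hN]
  exact Finset.sum_le_sum fun i _ => mul_le_of_le_one_right (hα i) (hv i).2

lemma weightedMean_eq_sum (α v : Fin S → ℝ) :
    weightedMean α v = ∑ s, α s / (∑ i, α i) * v s := by
  rw [weightedMean, Finset.sum_div]
  exact Finset.sum_congr rfl fun s _ => by ring

lemma sum_incr_mul (α v : Fin S → ℝ) (s : Fin S) :
    ∑ i, incr α s i * v i = ∑ i, α i * v i + v s := by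
  simp [incr, add_mul, Finset.sum_add_distrib]

lemma weightedMean_incr (hN : 0 < ∑ i, α i) (v : Fin S → ℝ) (s : Fin S) :
    weightedMean (incr α s) v =
      weightedMean α v + (v s - weightedMean α v) * (∑ i, α i + 1)⁻¹ := by
  have h : (∑ i, α i) * weightedMean α v = ∑ i, α i * v i := by
    rw [weightedMean]; field_simp
  have h1 : weightedMean (incr α s) v = (∑ i, α i * v i + v s) / (∑ i, α i + 1) := by
    rw [weightedMean, sum_incr_mul, sum_incr]
  rw [h1, ← h]
  field_simp
  ring

lemma integrable_dirichletMeasure (hα : ∀ i, 0 ≤ α i) (hN : 0 < ∑ i, α i) {f : (Fin S → ℝ) → ℝ}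
    (hf : Continuous f) : Integrable f (dirichletMeasure α) := by
  have := isProbabilityMeasure_dirichletMeasure hα
  obtain ⟨C, hC⟩ := (isCompact_stdSimplex ℝ (Fin S)).exists_bound_of_continuousOn hf.continuousOn
  exact Integrable.of_bound hf.aestronglyMeasurable C
    ((ae_dirichletMeasure_mem_stdSimplex hα hN).mono fun p hp => hC p hp)

/-- `dirichletMeasure_withDensity_coord` for expectations. -/
lemma integral_dirichletMeasure_coord_mul (hα : ∀ i, 0 ≤ α i) (hN : 0 < ∑ i, α i) (s : Fin S)
    (f : (Fin S → ℝ) → ℝ) :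
    ∫ p, p s * f p ∂dirichletMeasure α =
      α s / (∑ i, α i) * ∫ p, f p ∂dirichletMeasure (incr α s) := by
  have h := integral_withDensity_eq_integral_toReal_smul (μ := dirichletMeasure α)
    (f := fun p => ENNReal.ofReal (p s)) (by fun_prop)
    (ae_of_all _ fun p => ENNReal.ofReal_lt_top) f
  rw [dirichletMeasure_withDensity_coord hα hN, integral_smul_measure,
    ENNReal.toReal_ofReal (div_nonneg (hα s) hN.le), smul_eq_mul] at h
  rw [h]
  refine integral_congr_ae ?_
  filter_upwards [ae_dirichletMeasure_mem_stdSimplex hα hN] with p hp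
  rw [ENNReal.toReal_ofReal (hp.1 s), smul_eq_mul]

lemma integral_dirichletMeasure_eq_sum (hα : ∀ i, 0 ≤ α i) (hN : 0 < ∑ i, α i)
    {f : (Fin S → ℝ) → ℝ} (hf : Continuous f) :
    ∫ p, f p ∂dirichletMeasure α =
      ∑ s, α s / (∑ i, α i) * ∫ p, f p ∂dirichletMeasure (incr α s) := by
  simp_rw [← integral_dirichletMeasure_coord_mul hα hN]
  rw [← integral_finsetSum _ fun s _ =>
    integrable_dirichletMeasure hα hN (f := fun p => p s * f p) (by fun_prop)]
  refine integral_congr_ae ?_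
  filter_upwards [ae_dirichletMeasure_mem_stdSimplex hα hN] with p hp
  rw [← Finset.sum_mul, hp.2, one_mul]

lemma integral_dirichletMeasure_average (hα : ∀ i, 0 ≤ α i) (hN : 0 < ∑ i, α i) (v : Fin S → ℝ) :
    ∫ p, (∑ s, p s * v s) ∂dirichletMeasure α = weightedMean α v := by
  rw [integral_finsetSum _ fun s _ => integrable_dirichletMeasure hα hN (by fun_prop),
    weightedMean_eq_sum]
  refine Finset.sum_congr rfl fun s _ => ?_
  have := isProbabilityMeasure_dirichletMeasure (incr_nonneg hα s)
  rw [integral_dirichletMeasure_coord_mul hα hN s fun _ => v s]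
  simp

/-- A Dirichlet average of values in `[0, 1]` has variance at most `1 / (∑ α + 1)`. -/
lemma integral_dirichletMeasure_sq_le (hα : ∀ i, 0 ≤ α i) (hN : 0 < ∑ i, α i) {v : Fin S → ℝ}
    (hv : ∀ s, v s ∈ Set.Icc (0 : ℝ) 1) :
    ∫ p, (∑ s, p s * v s - weightedMean α v) ^ 2 ∂dirichletMeasure α ≤ (∑ i, α i + 1)⁻¹ := by
  have hprob := isProbabilityMeasure_dirichletMeasure hα
  set m := weightedMean α v with hm
  have hm01 : m ∈ Set.Icc (0 : ℝ) 1 := weightedMean_mem_Icc hα hN hv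
  have hcent : ∀ s, ∫ p, (∑ s, p s * v s - m) ∂dirichletMeasure (incr α s) =
      (v s - m) * (∑ i, α i + 1)⁻¹ := by
    intro s
    have h' := isProbabilityMeasure_dirichletMeasure (incr_nonneg hα s)
    have hN' : 0 < ∑ i, incr α s i := by rw [sum_incr]; linarith
    rw [integral_sub (integrable_dirichletMeasure (incr_nonneg hα s) hN' (by fun_prop))
      (integrable_const _), integral_dirichletMeasure_average (incr_nonneg hα s) hN',
      weightedMean_incr hN]
    simp [hm]
  have hzero : ∫ p, (∑ s, p s * v s - m) ∂dirichletMeasure α = 0 := by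
    rw [integral_sub (integrable_dirichletMeasure hα hN (by fun_prop)) (integrable_const _),
      integral_dirichletMeasure_average hα hN]
    simp [hm]
  -- `(X - m)² = X (X - m) - m (X - m)`, and the weights in `X` shift the parameter
  have hexp : ∀ p : Fin S → ℝ, (∑ s, p s * v s - m) ^ 2 =
      ∑ s, v s * (p s * (∑ s, p s * v s - m)) - m * (∑ s, p s * v s - m) := by
    intro p
    have : ∑ s, v s * (p s * (∑ s, p s * v s - m)) =
        (∑ s, p s * v s) * (∑ s, p s * v s - m) := by
      rw [Finset.sum_mul]
      exact Finset.sum_congr rfl fun s _ => by ring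
    rw [this]; ring
  simp_rw [hexp]
  rw [integral_sub (integrable_dirichletMeasure hα hN (by fun_prop))
    (integrable_dirichletMeasure hα hN (by fun_prop)), integral_const_mul, hzero, mul_zero,
    sub_zero,
    integral_finsetSum _ fun s _ => integrable_dirichletMeasure hα hN (by fun_prop)]
  have hM : 0 < (∑ i, α i + 1)⁻¹ := by positivity
  calc _ = ∑ s, α s / (∑ i, α i) * (v s * (v s - m) * (∑ i, α i + 1)⁻¹) := by
        refine Finset.sum_congr rfl fun s _ => ?_
        rw [integral_const_mul, integral_dirichletMeasure_coord_mul hα hN, hcent]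
        ring
    _ ≤ ∑ s, α s / (∑ i, α i) * (∑ i, α i + 1)⁻¹ := by
        refine Finset.sum_le_sum fun s _ => mul_le_mul_of_nonneg_left ?_
          (div_nonneg (hα s) hN.le)
        refine mul_le_of_le_one_left hM.le ?_
        have h1 := hv s
        nlinarith [h1.1, h1.2, hm01.1]
    _ = (∑ i, α i + 1)⁻¹ := by
        rw [← Finset.sum_mul, ← Finset.sum_div, div_self hN.ne', one_mul]

/-- For large total parameter a Dirichlet average is close to its mean. -/
lemma LipschitzWith.sub_le_integral_dirichletMeasure {w : ℝ → ℝ} {K : NNReal}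
    (hK : LipschitzWith K w) (hα : ∀ i, 0 ≤ α i) (hN : 0 < ∑ i, α i) {v : Fin S → ℝ}
    (hv : ∀ s, v s ∈ Set.Icc (0 : ℝ) 1) :
    w (weightedMean α v) - K * (√(∑ i, α i + 1))⁻¹ ≤
      ∫ p, w (∑ s, p s * v s) ∂dirichletMeasure α := by
  have hprob := isProbabilityMeasure_dirichletMeasure hα
  set m := weightedMean α v with hm
  set r := √(∑ i, α i + 1) with hr
  have hr0 : 0 < r := Real.sqrt_pos.2 (by linarith)
  have hr2 : r ^ 2 = ∑ i, α i + 1 := Real.sq_sqrt (by linarith)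
  have hvar := integral_dirichletMeasure_sq_le hα hN hv
  rw [← hm, ← hr2] at hvar
  -- `|x| ≤ (r⁻¹ + r x²) / 2`, where `r⁻¹` bounds the standard deviation
  have hpt : ∀ x, w m - K * (r⁻¹ / 2 + r / 2 * (x - m) ^ 2) ≤ w x := by
    intro x
    have h1 := hK.dist_le_mul m x
    rw [Real.dist_eq, Real.dist_eq, abs_sub_comm m x] at h1
    have h2 : |x - m| ≤ r⁻¹ / 2 + r / 2 * (x - m) ^ 2 := by
      have h3 : 0 ≤ r⁻¹ / 2 * (r * |x - m| - 1) ^ 2 := by positivity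
      have h4 : r⁻¹ / 2 * (r * |x - m| - 1) ^ 2 =
          r⁻¹ / 2 + r / 2 * |x - m| ^ 2 - |x - m| := by
        field_simp
        ring
      rw [h4, sq_abs] at h3
      linarith
    have h3 := mul_le_mul_of_nonneg_left h2 K.2
    have h4 := le_abs_self (w m - w x)
    have h5 : (K : ℝ) * |x - m| ≤ K * (r⁻¹ / 2 + r / 2 * (x - m) ^ 2) := h3
    linarith
  have hsq : Integrable (fun p : Fin S → ℝ => (∑ s, p s * v s - m) ^ 2) (dirichletMeasure α) :=
    integrable_dirichletMeasure hα hN (by fun_prop)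
  calc w m - K * r⁻¹
      ≤ w m - K * (r⁻¹ / 2 +
          r / 2 * ∫ p, (∑ s, p s * v s - m) ^ 2 ∂dirichletMeasure α) := by
        have h1 : r / 2 * ∫ p, (∑ s, p s * v s - m) ^ 2 ∂dirichletMeasure α ≤ r⁻¹ / 2 := by
          calc _ ≤ r / 2 * (r ^ 2)⁻¹ := mul_le_mul_of_nonneg_left hvar (by positivity)
            _ = r⁻¹ / 2 := by field_simp
        have h2 := mul_le_mul_of_nonneg_left
          (show r⁻¹ / 2 + r / 2 * ∫ p, (∑ s, p s * v s - m) ^ 2 ∂dirichletMeasure α ≤ r⁻¹ by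
            linarith) K.2
        exact sub_le_sub_left h2 _
    _ = ∫ p, (w m - K * (r⁻¹ / 2 + r / 2 * (∑ s, p s * v s - m) ^ 2)) ∂dirichletMeasure α := by
        rw [integral_sub (integrable_const _) (integrable_dirichletMeasure hα hN (by fun_prop)),
          integral_const_mul,
          integral_add (integrable_const _) (hsq.const_mul _), integral_const_mul]
        simp
    _ ≤ _ := integral_mono (integrable_dirichletMeasure hα hN (by fun_prop))
        (integrable_dirichletMeasure hα hN (hK.continuous.comp (by fun_prop))) fun p => hpt _

/-- One step of the Pólya urn: the normal law with the parameters of the Dirichlet law `α` is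
dominated by the mixture of those that belong to the laws with one parameter raised. The variance
splits as `1 / N = 1 / (N (N + 1)) + 1 / (N + 1)`, and the first part covers the move of the mean,
which takes place in an interval of length `1 / (N + 1)`. -/
lemma ConcaveOn.integral_gaussianReal_le_sum_incr {w : ℝ → ℝ} (hw : ConcaveOn ℝ Set.univ w)
    {K : NNReal} (hK : LipschitzWith K w) (hα : ∀ i, 0 ≤ α i) (hN : 0 < ∑ i, α i)
    {v : Fin S → ℝ} (hv : ∀ s, v s ∈ Set.Icc (0 : ℝ) 1) :
    ∫ x, w x ∂gaussianReal (weightedMean α v) (Real.toNNReal (∑ i, α i)⁻¹) ≤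
      ∑ s, α s / (∑ i, α i) * ∫ x, w x ∂gaussianReal (weightedMean (incr α s) v)
        (Real.toNNReal (∑ i, incr α s i)⁻¹) := by
  have hsum : ∑ s, α s / (∑ i, α i) = 1 := by rw [← Finset.sum_div, div_self hN.ne']
  have hmean : ∑ s, α s / (∑ i, α i) * v s = weightedMean α v := (weightedMean_eq_sum α v).symm
  have hm01 := weightedMean_mem_Icc hα hN hv
  set N := ∑ i, α i with hNdef
  set m := weightedMean α v with hm
  have hN1 : 0 < N + 1 := by linarith
  have hvar : Real.toNNReal N⁻¹ = Real.toNNReal (N * (N + 1))⁻¹ + Real.toNNReal (N + 1)⁻¹ := by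
    rw [← Real.toNNReal_add (by positivity) (by positivity)]
    congr 1
    field_simp
    ring
  have hd : ((N + 1)⁻¹) ^ 2 ≤ (Real.toNNReal (N * (N + 1))⁻¹ : ℝ) := by
    rw [Real.coe_toNNReal _ (by positivity), inv_pow]
    exact inv_anti₀ (by positivity) (by nlinarith)
  rw [hvar, integral_gaussianReal_add_var hK]
  have hg := hw.gaussianSmoothing hK (Real.toNNReal (N + 1)⁻¹)
  refine (hg.integral_gaussianReal_le_two_point (hK.gaussianSmoothing _) hm01.1 hm01.2
    (inv_pos.2 hN1) hd m).trans ?_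
  refine (hg.two_point_le_sum (fun s => div_nonneg (hα s) hN.le) hsum hv hmean m
    (N + 1)⁻¹).trans (le_of_eq ?_)
  refine Finset.sum_congr rfl fun s _ => ?_
  rw [integral_gaussianReal_eq_gaussianSmoothing hK, weightedMean_incr hN, sum_incr]

/-- Iterating the urn `k` times leaves an error that the concentration of the Dirichlet law
controls. -/
lemma ConcaveOn.integral_gaussianReal_sub_le_dirichletMeasure {w : ℝ → ℝ}
    (hw : ConcaveOn ℝ Set.univ w) {K : NNReal} (hK : LipschitzWith K w) {v : Fin S → ℝ}
    (hv : ∀ s, v s ∈ Set.Icc (0 : ℝ) 1) (k : ℕ) :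
    ∀ {α : Fin S → ℝ}, (∀ i, 0 ≤ α i) → 0 < ∑ i, α i →
    ∫ x, w x ∂gaussianReal (weightedMean α v) (Real.toNNReal (∑ i, α i)⁻¹) -
        K * (√(∑ i, α i + k + 1))⁻¹ ≤
      ∫ p, w (∑ s, p s * v s) ∂dirichletMeasure α := by
  induction k with
  | zero =>
    intro α hα hN
    have h1 := hK.sub_le_integral_dirichletMeasure hα hN hv
    have h2 := hw.integral_gaussianReal_le hK (weightedMean α v) (Real.toNNReal (∑ i, α i)⁻¹)
    simp only [Nat.cast_zero, add_zero]
    linarith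
  | succ k ih =>
    intro α hα hN
    have h1 := hw.integral_gaussianReal_le_sum_incr hK hα hN hv
    have hsum : ∑ s, α s / (∑ i, α i) = 1 := by rw [← Finset.sum_div, div_self hN.ne']
    rw [integral_dirichletMeasure_eq_sum hα hN (f := fun p => w (∑ s, p s * v s))
      (hK.continuous.comp (by fun_prop))]
    calc _ ≤ ∑ s, α s / (∑ i, α i) * ∫ x, w x ∂gaussianReal (weightedMean (incr α s) v)
          (Real.toNNReal (∑ i, incr α s i)⁻¹) - K * (√(∑ i, α i + (k + 1 : ℕ) + 1))⁻¹ :=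
          sub_le_sub_right h1 _
      _ = ∑ s, α s / (∑ i, α i) * (∫ x, w x ∂gaussianReal (weightedMean (incr α s) v)
          (Real.toNNReal (∑ i, incr α s i)⁻¹) - K * (√(∑ i, incr α s i + k + 1))⁻¹) := by
          have e : ∀ s, ∑ i, incr α s i + k + 1 = ∑ i, α i + (k + 1 : ℕ) + 1 := by
            intro s
            rw [sum_incr]
            push_cast
            ring
          simp_rw [e, mul_sub]
          rw [Finset.sum_sub_distrib, ← Finset.sum_mul, hsum, one_mul]
      _ ≤ _ := Finset.sum_le_sum fun s _ => mul_le_mul_of_nonneg_left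
          (ih (incr_nonneg hα s) (by rw [sum_incr]; linarith)) (div_nonneg (hα s) hN.le)

/-- A Dirichlet average of values in `[0, 1]` dominates the normal law with the same mean and with
variance the inverse of the total parameter. -/
theorem ConcaveOn.integral_gaussianReal_le_dirichletMeasure {w : ℝ → ℝ}
    (hw : ConcaveOn ℝ Set.univ w) {K : NNReal} (hK : LipschitzWith K w) {v : Fin S → ℝ}
    (hv : ∀ s, v s ∈ Set.Icc (0 : ℝ) 1) (hα : ∀ i, 0 ≤ α i) (hN : 0 < ∑ i, α i) :
    ∫ x, w x ∂gaussianReal (weightedMean α v) (Real.toNNReal (∑ i, α i)⁻¹) ≤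
      ∫ p, w (∑ s, p s * v s) ∂dirichletMeasure α := by
  have hlim : Filter.Tendsto (fun k : ℕ =>
      ∫ x, w x ∂gaussianReal (weightedMean α v) (Real.toNNReal (∑ i, α i)⁻¹) -
        K * (√(∑ i, α i + k + 1))⁻¹) Filter.atTop
      (nhds (∫ x, w x ∂gaussianReal (weightedMean α v) (Real.toNNReal (∑ i, α i)⁻¹) -
        K * 0)) := by
    refine Filter.Tendsto.const_sub _ (Filter.Tendsto.const_mul _ ?_)
    refine (Real.tendsto_sqrt_atTop.comp ?_).inv_tendsto_atTop
    exact Filter.tendsto_atTop_add_const_right _ _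
      (Filter.tendsto_atTop_add_const_left _ _ tendsto_natCast_atTop_atTop)
  rw [mul_zero, sub_zero] at hlim
  exact le_of_tendsto' hlim fun k =>
    hw.integral_gaussianReal_sub_le_dirichletMeasure hK hv k hα hN

end Dominance

/-! ### Conditioning on the data -/

section Posterior

variable {S : ℕ} {α : Fin S → ℝ}

/-- The Dirichlet parameter after observing the categories `z`: each observation adds one to the
parameter of its category. -/
noncomputable def posteriorParam (α : Fin S → ℝ) {n : ℕ} (z : Fin n → Fin S) (s : Fin S) : ℝ :=
  α s + ∑ i, if s = z i then 1 else 0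

lemma posteriorParam_nonneg (hα : ∀ i, 0 ≤ α i) {n : ℕ} (z : Fin n → Fin S) (s : Fin S) :
    0 ≤ posteriorParam α z s :=
  add_nonneg (hα s) (Finset.sum_nonneg fun i _ => by split_ifs <;> simp)

lemma sum_posteriorParam_mul (α v : Fin S → ℝ) {n : ℕ} (z : Fin n → Fin S) :
    ∑ s, posteriorParam α z s * v s = ∑ s, α s * v s + ∑ i, v (z i) := by
  simp only [posteriorParam, add_mul, Finset.sum_add_distrib, Finset.sum_mul]
  rw [Finset.sum_comm]
  simp

lemma sum_posteriorParam (α : Fin S → ℝ) {n : ℕ} (z : Fin n → Fin S) :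
    ∑ s, posteriorParam α z s = ∑ s, α s + n := by
  simpa using sum_posteriorParam_mul α (fun _ => 1) z

lemma posteriorParam_incr (α : Fin S → ℝ) {n : ℕ} (z : Fin (n + 1) → Fin S) :
    posteriorParam (incr α (z 0)) (fun i => z i.succ) = posteriorParam α z := by
  funext s
  simp only [posteriorParam, incr, Fin.sum_univ_succ]
  ring

lemma gaussianPosterior_eq_posteriorParam (hN : 0 < ∑ i, α i) (v : Fin S → ℝ) {n : ℕ}
    (z : Fin n → Fin S) :
    gaussianPosterior ((∑ s, α s * v s) / ∑ s, α s) (Real.toNNReal (∑ s, α s)⁻¹)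
        (fun i => v (z i)) =
      gaussianReal (weightedMean (posteriorParam α z) v)
        (Real.toNNReal (∑ s, posteriorParam α z s)⁻¹) := by
  rw [gaussianPosterior_eq hN, weightedMean, sum_posteriorParam, sum_posteriorParam_mul,
    mul_div_cancel₀ _ hN.ne']

/-- Conjugacy: weighting a Dirichlet law by the likelihood of a sample gives a multiple of the
Dirichlet law with the updated parameter. -/
lemma exists_dirichletMeasure_withDensity_prod {n : ℕ} (z : Fin n → Fin S) :
    ∀ {α : Fin S → ℝ}, (∀ i, 0 ≤ α i) → 0 < ∑ i, α i →
    ∃ c : ℝ≥0∞, c ≠ ∞ ∧ ((∀ i, 0 < α (z i)) → c ≠ 0) ∧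
      (dirichletMeasure α).withDensity (fun p => ∏ i, ENNReal.ofReal (p (z i))) =
        c • dirichletMeasure (posteriorParam α z) := by
  induction n with
  | zero =>
    intro α hα hN
    refine ⟨1, by simp, by simp, ?_⟩
    have : posteriorParam α z = α := by funext s; simp [posteriorParam]
    have h1 : (fun _ : Fin S → ℝ => (1 : ℝ≥0∞)) = 1 := rfl
    simp [this, h1]
  | succ n ih =>
    intro α hα hN
    obtain ⟨c, hc, hc0, h⟩ := ih (fun i => z i.succ) (incr_nonneg hα (z 0))
      (by rw [sum_incr]; linarith)
    refine ⟨ENNReal.ofReal (α (z 0) / ∑ i, α i) * c, ENNReal.mul_ne_top (by simp) hc,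
      fun hpos => mul_ne_zero ?_ (hc0 fun i => ?_), ?_⟩
    · simpa using div_pos (hpos 0) hN
    · exact add_pos_of_pos_of_nonneg (hpos i.succ) (by split_ifs <;> simp)
    · have hsplit : (fun p : Fin S → ℝ => ∏ i, ENNReal.ofReal (p (z i))) =
          (fun p => ENNReal.ofReal (p (z 0))) *
            fun p => ∏ i : Fin n, ENNReal.ofReal (p (z i.succ)) := by
        funext p
        rw [Fin.prod_univ_succ, Pi.mul_apply]
      rw [hsplit, withDensity_mul _ (by fun_prop) (by fun_prop),
        dirichletMeasure_withDensity_coord hα hN, withDensity_smul_measure, h, smul_smul,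
        posteriorParam_incr]

section

variable {Ω : Type*} [MeasurableSpace Ω] {Pr : Measure Ω}
  {P : Ω → Fin S → ℝ} {n : ℕ} {Z : Fin n → Ω → Fin S}

lemma ae_mem_stdSimplex_of_map_eq (hα : ∀ i, 0 ≤ α i) (hN : 0 < ∑ i, α i) (hP : Measurable P)
    (hP_law : Pr.map P = dirichletMeasure α) : ∀ᵐ ω ∂Pr, P ω ∈ stdSimplex ℝ (Fin S) := by
  have h := ae_dirichletMeasure_mem_stdSimplex hα hN
  rw [← hP_law] at h
  exact ae_of_ae_map hP.aemeasurable h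

lemma measurableSet_sample_eq (hZ : ∀ i, Measurable (Z i)) (z : Fin n → Fin S) :
    MeasurableSet {ω | ∀ i, Z i ω = z i} := by
  rw [Set.ofPred_forall]
  exact MeasurableSet.iInter fun i => hZ i (measurableSet_singleton (z i))

/-- The joint law of the parameter and the sample: on the event that the sample is `z`, the
parameter has the prior law weighted by the likelihood of `z`. -/
lemma restrict_map_eq_withDensity [IsProbabilityMeasure Pr] (hα : ∀ i, 0 ≤ α i)
    (hN : 0 < ∑ i, α i) (hP : Measurable P) (hP_law : Pr.map P = dirichletMeasure α)
    (hZ : ∀ i, Measurable (Z i)) (hZ_law : IsIIDCategoricalGiven Pr P Z) (z : Fin n → Fin S) :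
    (Pr.restrict {ω | ∀ i, Z i ω = z i}).map P =
      (dirichletMeasure α).withDensity (fun p => ∏ i, ENNReal.ofReal (p (z i))) := by
  have hE := measurableSet_sample_eq hZ z
  have hm : MeasurableSpace.comap P inferInstance ≤ (inferInstance : MeasurableSpace Ω) :=
    hP.comap_le
  have hint : Integrable ({ω | ∀ i, Z i ω = z i}.indicator fun _ => (1 : ℝ)) Pr :=
    (integrable_const _).indicator hE
  have hprod : Integrable (fun ω => ∏ i, P ω (z i)) Pr := integrable_condExp.congr (hZ_law z)
  ext B hB
  have hPB := hP hB
  have h1 := setIntegral_condExp hm hint (s := P ⁻¹' B) ⟨B, hB, rfl⟩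
  rw [setIntegral_congr_ae hPB ((hZ_law z).mono fun ω h _ => h), integral_indicator hE] at h1
  simp only [integral_const, smul_eq_mul, mul_one, measureReal_restrict_apply MeasurableSet.univ,
    Set.univ_inter] at h1
  rw [measureReal_restrict_apply hE] at h1
  rw [Measure.map_apply hP hB, Measure.restrict_apply hPB, withDensity_apply _ hB, ← hP_law,
    setLIntegral_map hB (by fun_prop) hP, Set.inter_comm, ← ofReal_measureReal, ← h1,
    ofReal_integral_eq_lintegral_ofReal hprod.integrableOn]
  · refine lintegral_congr_ae (ae_restrict_of_ae ?_)
    filter_upwards [ae_mem_stdSimplex_of_map_eq hα hN hP hP_law] with ω hω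
    rw [ENNReal.ofReal_prod_of_nonneg fun i _ => hω.1 _]
  · refine ae_restrict_of_ae ?_
    filter_upwards [ae_mem_stdSimplex_of_map_eq hα hN hP hP_law] with ω hω
    exact Finset.prod_nonneg fun i _ => hω.1 _

/-- Dominance after conditioning on the event that the sample lies in a set `D` of datasets that
carry the same values as `z`: the conditional law is a mixture of Dirichlet averages, all of which
dominate the same normal law. -/
theorem secondOrderDominates_cond_mem [IsProbabilityMeasure Pr] (hα : ∀ i, 0 ≤ α i)
    (hN : 0 < ∑ i, α i) (hP : Measurable P) (hP_law : Pr.map P = dirichletMeasure α)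
    (hZ : ∀ i, Measurable (Z i)) (hZ_law : IsIIDCategoricalGiven Pr P Z) {v : Fin S → ℝ}
    (hv : ∀ s, v s ∈ Set.Icc (0 : ℝ) 1) {z : Fin n → Fin S} (hz : ∀ i, 0 < α (z i))
    {D : Finset (Fin n → Fin S)} (hzD : z ∈ D) (hD : ∀ y ∈ D, ∀ i, v (y i) = v (z i)) :
    SecondOrderDominates
      ((Pr[|{ω | (fun i => Z i ω) ∈ D}]).map fun ω => ∑ s, P ω s * v s)
      (gaussianPosterior ((∑ s, α s * v s) / ∑ s, α s) (Real.toNNReal (∑ s, α s)⁻¹)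
        fun i => v (z i)) := by
  choose c hctop hc0 hc using fun y : Fin n → Fin S =>
    exists_dirichletMeasure_withDensity_prod y hα hN
  have hX : Measurable fun p : Fin S → ℝ => ∑ s, p s * v s := by fun_prop
  set E := {ω | (fun i => Z i ω) ∈ D} with hEdef
  have hE : E = ⋃ y ∈ D, {ω | ∀ i, Z i ω = y i} := by
    ext ω
    simp only [hEdef, Set.mem_ofPred_eq, Set.mem_iUnion, exists_prop]
    constructor
    · exact fun h => ⟨_, h, fun i => rfl⟩
    · rintro ⟨y, hy, h⟩
      rwa [show (fun i => Z i ω) = y from funext h]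
  have hmix : (Pr.restrict E).map P = ∑ y ∈ D, c y • dirichletMeasure (posteriorParam α y) := by
    have hdisj : (D : Set (Fin n → Fin S)).PairwiseDisjoint fun y => {ω | ∀ i, Z i ω = y i} := by
      intro y _ y' _ hne
      refine Set.disjoint_left.2 fun ω h h' => hne (funext fun i => ?_)
      rw [← h i, ← h' i]
    ext B hB
    rw [Measure.map_apply hP hB, Measure.restrict_apply (hP hB), hE, Set.inter_iUnion₂,
      measure_biUnion_finset, Measure.finsetSum_apply]
    · refine Finset.sum_congr rfl fun y _ => ?_
      rw [← hc y, ← restrict_map_eq_withDensity hα hN hP hP_law hZ hZ_law y,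
        Measure.map_apply hP hB, Measure.restrict_apply (hP hB)]
    · exact fun y hy y' hy' hne => (hdisj hy hy' hne).mono Set.inter_subset_right
        Set.inter_subset_right
    · exact fun y _ => (hP hB).inter (measurableSet_sample_eq hZ y)
  have hN' : ∀ y : Fin n → Fin S, 0 < ∑ s, posteriorParam α y s := fun y => by
    rw [sum_posteriorParam]; positivity
  have hprobD := fun y : Fin n → Fin S =>
    isProbabilityMeasure_dirichletMeasure (posteriorParam_nonneg hα y)
  have hmass : Pr E = ∑ y ∈ D, c y := by
    have h := congrArg (fun μ : Measure (Fin S → ℝ) => μ Set.univ) hmix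
    simpa [Measure.map_apply hP MeasurableSet.univ, Measure.finsetSum_apply] using h
  have hE0 : Pr E ≠ 0 := by
    rw [hmass]
    exact fun h => hc0 z hz (Finset.sum_eq_zero_iff.1 h z hzD)
  have : IsProbabilityMeasure Pr[|E] := cond_isProbabilityMeasure hE0
  have hXP : Measurable fun ω => ∑ s, P ω s * v s := hX.comp hP
  have : IsProbabilityMeasure ((Pr[|E]).map fun ω => ∑ s, P ω s * v s) :=
    Measure.isProbabilityMeasure_map hXP.aemeasurable
  have h01 : ∀ᵐ x ∂((Pr[|E]).map fun ω => ∑ s, P ω s * v s), x ∈ Set.Icc (0 : ℝ) 1 := by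
    have hIcc : MeasurableSet {x | x ∈ Set.Icc (0 : ℝ) 1} := measurableSet_Icc
    rw [ae_map_iff hXP.aemeasurable hIcc]
    refine cond_absolutelyContinuous.ae_le ?_
    filter_upwards [ae_mem_stdSimplex_of_map_eq hα hN hP hP_law] with ω hω
    refine ⟨Finset.sum_nonneg fun s _ => mul_nonneg (hω.1 s) (hv s).1, ?_⟩
    rw [← hω.2]
    exact Finset.sum_le_sum fun s _ => mul_le_of_le_one_right (hω.1 s) (hv s).2
  have hid : Integrable (fun x : ℝ => x) ((Pr[|E]).map fun ω => ∑ s, P ω s * v s) :=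
    Integrable.of_bound aestronglyMeasurable_id 1
      (h01.mono fun x hx => by rw [Real.norm_eq_abs, abs_of_nonneg hx.1]; exact hx.2)
  rw [gaussianPosterior_eq_posteriorParam hN]
  refine secondOrderDominates_of_lipschitz h01 (fun w K hK => hK.integrable_of_integrable_id hid)
    (fun w K hK => hK.integrable_gaussianReal _ _) fun w K hw hK => ?_
  set I := ∫ x, w x ∂gaussianReal (weightedMean (posteriorParam α z) v)
    (Real.toNNReal (∑ s, posteriorParam α z s)⁻¹) with hI
  have hwX : Continuous fun p : Fin S → ℝ => w (∑ s, p s * v s) := hK.continuous.comp (by fun_prop)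
  have hcomp : ∀ y ∈ D, I ≤ ∫ p, w (∑ s, p s * v s) ∂dirichletMeasure (posteriorParam α y) := by
    intro y hy
    refine le_trans (le_of_eq ?_) (hw.integral_gaussianReal_le_dirichletMeasure hK hv
      (posteriorParam_nonneg hα y) (hN' y))
    rw [hI, weightedMean, weightedMean, sum_posteriorParam, sum_posteriorParam,
      sum_posteriorParam_mul, sum_posteriorParam_mul]
    simp only [hD y hy]
  have hval : ∫ x, w x ∂((Pr[|E]).map fun ω => ∑ s, P ω s * v s) = (Pr E).toReal⁻¹ *
      ∑ y ∈ D, (c y).toReal * ∫ p, w (∑ s, p s * v s) ∂dirichletMeasure (posteriorParam α y) := by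
    rw [integral_map hXP.aemeasurable hK.continuous.aestronglyMeasurable, ProbabilityTheory.cond,
      integral_smul_measure, ← integral_map (f := fun p : Fin S → ℝ => w (∑ s, p s * v s))
      hP.aemeasurable hwX.aestronglyMeasurable, hmix, integral_finsetSum_measure fun y _ =>
      (integrable_dirichletMeasure (posteriorParam_nonneg hα y) (hN' y) hwX).smul_measure (hctop y)]
    simp [integral_smul_measure]
  have hpos : 0 < (Pr E).toReal := ENNReal.toReal_pos hE0 (measure_ne_top _ _)
  rw [hval, le_inv_mul_iff₀ hpos, hmass, ENNReal.toReal_sum fun y _ => hctop y, Finset.sum_mul]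
  exact Finset.sum_le_sum fun y hy => mul_le_mul_of_nonneg_left (hcomp y hy) ENNReal.toReal_nonneg

end

end Posterior

/-! ### Both kinds of data -/

theorem corollary1 {Ω : Type*} [MeasurableSpace Ω] (Pr : Measure Ω) [IsProbabilityMeasure Pr]
    {S : ℕ} (v : Fin S → ℝ) (hv : ∀ s, v s ∈ Set.Icc (0 : ℝ) 1)
    (α : Fin S → ℝ) (hα : ∀ s, 0 ≤ α s) (hα_pos : 0 < ∑ s, α s)
    (P : Ω → Fin S → ℝ) (hP : Measurable P) (hP_law : Pr.map P = dirichletMeasure α)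
    (n : ℕ) (Z : Fin n → Ω → Fin S) (hZ : ∀ i, Measurable (Z i))
    (hZ_law : IsIIDCategoricalGiven Pr P Z)
    (z : Fin n → Fin S) (hz : ∀ i, 0 < α (z i)) (hn : 2 ≤ (n : ℝ) + ∑ s, α s) :
    -- the data record the sampled categories
    SecondOrderDominates
        ((Pr[|{ω | ∀ i, Z i ω = z i}]).map fun ω => ∑ s, P ω s * v s)
        (gaussianPosterior ((∑ s, α s * v s) / ∑ s, α s) (Real.toNNReal (∑ s, α s)⁻¹)
          fun i => v (z i)) ∧
    -- the data record only the sampled values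
    SecondOrderDominates
        ((Pr[|{ω | ∀ i, v (Z i ω) = v (z i)}]).map fun ω => ∑ s, P ω s * v s)
        (gaussianPosterior ((∑ s, α s * v s) / ∑ s, α s) (Real.toNNReal (∑ s, α s)⁻¹)
          fun i => v (z i)) := by

  classical
  constructor
  · have h := secondOrderDominates_cond_mem hα hα_pos hP hP_law hZ hZ_law hv hz
      (D := {z}) (by simp) (by simp)
    simpa only [Finset.mem_singleton, funext_iff] using h
  · have h := secondOrderDominates_cond_mem hα hα_pos hP hP_law hZ hZ_law hv hz
      (D := Finset.univ.filter fun y => ∀ i, v (y i) = v (z i)) (by simp) (by simp)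
    simpa only [Finset.mem_filter, Finset.mem_univ, true_and] using h
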